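/- Let $(R,\mathfrak M)$ be an admissible ring, that is, a noetherian one-dimensional Cohen–Macaulay local ring with total ring of fractions $Q$ and integral closure $\widetilde R$ in $Q$, such that: the $\mathfrak M$-adic completion of $R$ is reduced; $R/\mathfrak M\to\widetilde R/\mathfrak n$ is surjective for every maximal ideal $\mathfrak n$ of $\widetilde R$; and $\#(R/\mathfrak M)\ge r$, where $r$ is the number of (necessarily discrete) valuation rings of $Q$ over $R$. Let $v_1,\dots,v_r$ be the corresponding normalized valuations, $I=\{1,\dots,r\}$, $e=(1,\dots,1)\in\mathbb Z^r$, and $v(h)=(v_1(h),\dots,v_r(h))$ for regular $h\in Q$. A regular fractional ideal is an $R$-submodule $\mathcal I\subset Q$ that contains a regular element of $Q$ and satisfies $d\,\mathcal I\subset R$ for some regular $d\in R$. For such an $\mathcal I$ put $E(\mathcal I)=\{v(h) : h\in\mathcal I \text{ regular in } Q\}\subset\mathbb Z^r$, let $c(\mathcal I)$ be the least $\gamma\in E(\mathcal I)$ (componentwise order) with $\gamma+\mathbb N^r\subset E(\mathcal I)$, and put $\mathfrak f(\mathcal I)=c(\mathcal I)-e$. Write $\mathcal J:\mathcal I=\{x\in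 Q : x\mathcal I\subset\mathcal J\}$. For $E\subset\mathbb Z^r$, $\alpha\in\mathbb Z^r$ and $\emptyset\ne K\subset I$ let $$F_K(E,\alpha)=\{\beta\in E : \beta_i=\alpha_i\ \forall i\in K,\ \beta_i>\alpha_i\ \forall i\in I\setminus K\},$$ $$p(E,\alpha)=\max\{0\le n\le r : F_K(E,\alpha)=\emptyset\text{ for all }\emptyset\neq K\subset I\text{ with }\#K\le n\},$$ $$q(E,\alpha)=\min\{n\ge 1 : F_K(E,\alpha)\ne\emptyset\text{ for all }\emptyset\neq K\subset I\text{ with }\#K\ge n\}.$$ A point $\alpha\in E$ is a maximal of $E$ if $F_{\{i\}}(E,\alpha)=\emptyset$ for all $i\in I$; it is a maximal of type $(p,q)$ if moreover $p=p(E,\alpha)\ge1$ and $q=q(E,\alpha)\le r$. For regular fractional ideals $\mathcal I,\mathcal J$ and $\alpha\in\mathbb Z^r$ put $$\rho_{\mathcal J}(\mathcal I,\alpha)=p(E(\mathcal I),\alpha)+q(E(\mathcal J:\mathcal I),\mathfrak f(\mathcal J)-\alpha)-1.$$ **Theorem (Symmetry of maximals).** Let $\mathcal I$ and $\mathcal J$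 be regular fractional ideals of $R$. Suppose that $\alpha\in E(\mathcal I)$ and $\mathfrak f(\mathcal J)-\alpha\in E(\mathcal J:\mathcal I)$. Then $\alpha$ is a maximal of $E(\mathcal I)$ if and only if $\mathfrak f(\mathcal J)-\alpha$ is a maximal of $E(\mathcal J:\mathcal I)$. Moreover, if $\alpha$ is a maximal of $E(\mathcal I)$ of type $(p,q)$, then $\mathfrak f(\mathcal J)-\alpha$ is a maximal of $E(\mathcal J:\mathcal I)$ of type $(p',q')$, where $$p'=\rho_{\mathcal J}\bigl(\mathcal J:\mathcal I,\ \mathfrak f(\mathcal J)-\alpha\bigr)+1-q\bigl(E(\mathcal J:(\mathcal J:\mathcal I)),\alpha\bigr),\qquad q'=\rho_{\mathcal J}(\mathcal I,\alpha)+1-p.$$ -/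

import Mathlib

open scoped nonZeroDivisors WithZero

noncomputable section

/-! ### Combinatorics of subsets of `ℤ^ι` -/

section Combinatorics

variable {ι : Type*}

/-- The fiber `F_J(E, α)` of `α` with respect to `J`. It is used only for nonempty `J`. -/
def fiber (E : Set (ι → ℤ)) (α : ι → ℤ) (J : Finset ι) : Set (ι → ℤ) :=
  {β | β ∈ E ∧ (∀ i ∈ J, β i = α i) ∧ ∀ i, i ∉ J → α i < β i}

/-- `α` is a maximal point of `E`: it lies in `E` and `F(E, α) = ⋃ i, F_{i}(E, α)` is empty. -/
def IsMaximalPoint (E : Set (ι → ℤ)) (α : ι → ℤ) : Prop :=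
  α ∈ E ∧ (⋃ i : ι, fiber E α {i}) = ∅

/-- `p(E, α)`, the largest `n` in `{0, …, r}` such that `F_J(E, α)` is empty for every nonempty
`J` with `#J ≤ n`. -/
def pInv (E : Set (ι → ℤ)) (α : ι → ℤ) : ℕ :=
  sSup {n : ℕ | n ≤ Nat.card ι ∧
    ∀ J : Finset ι, J.Nonempty → J.card ≤ n → fiber E α J = ∅}

/-- `q(E, α)`, the smallest `n ≥ 1` such that `F_J(E, α)` is nonempty for every (nonempty) `J`
with `#J ≥ n`. It is `r + 1` exactly if `α ∉ E`. -/
def qInv (E : Set (ι → ℤ)) (α : ι → ℤ) : ℕ :=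
  sInf {n : ℕ | 1 ≤ n ∧
    ∀ J : Finset ι, J.Nonempty → n ≤ J.card → (fiber E α J).Nonempty}

/-- `α` is a maximal point of `E` of type `(p, q)`. -/
def IsMaximalOfType (E : Set (ι → ℤ)) (α : ι → ℤ) (p q : ℤ) : Prop :=
  IsMaximalPoint E α ∧ 1 ≤ pInv E α ∧ qInv E α ≤ Nat.card ι ∧
    p = (pInv E α : ℤ) ∧ q = (qInv E α : ℤ)

/-- The conductor `c(E)`: the least `γ ∈ E` with `γ + ℕ^ι ⊆ E`
(an arbitrary vector if there is no such least element). -/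
def conductorVec (E : Set (ι → ℤ)) : ι → ℤ :=
  Classical.epsilon fun c => IsLeast {γ : ι → ℤ | γ ∈ E ∧ ∀ δ, γ ≤ δ → δ ∈ E} c

/-- The Frobenius vector `𝔣(E) = c(E) - (1, …, 1)`. -/
def frobeniusVec (E : Set (ι → ℤ)) : ι → ℤ :=
  conductorVec E - 1

end Combinatorics

/-! ### Admissible rings and value sets -/

section Rings

variable (R : Type*) [CommRing R] (Q : Type*) [CommRing Q] [Algebra R Q]

/-- The discrete valuation rings of `Q` over `R`, each given by its normalized valuation: a
valuation of the ring `Q` (multiplicatively written, with values in `ℤ ∪ {∞}` reversed) that is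
surjective and nonnegative on `R`. The valuation ring itself is `{x | v x ≤ 1}`. -/
def DiscreteValuationOver : Type _ :=
  {v : Valuation Q ℤᵐ⁰ // Function.Surjective v ∧ ∀ a : R, v (algebraMap R Q a) ≤ 1}

/-- A noetherian local ring `R` is Cohen-Macaulay if its maximal ideal contains an `R`-regular
sequence whose length is the dimension of `R`. -/
def IsCohenMacaulayLocal [IsLocalRing R] : Prop :=
  ∃ rs : List R, (∀ x ∈ rs, x ∈ IsLocalRing.maximalIdeal R) ∧
    RingTheory.Sequence.IsRegular R rs ∧ ((rs.length : ℕ∞) : WithBot ℕ∞) = ringKrullDim R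

/-- Admissible rings; `Q` is meant to be the total ring of fractions of `R`. -/
structure IsAdmissibleRing [IsLocalRing R] : Prop where
  noetherian : IsNoetherianRing R
  cohenMacaulay : IsCohenMacaulayLocal R
  dim_eq_one : ringKrullDim R = 1
  /-- analytically reduced: the completion is reduced -/
  analyticallyReduced : IsReduced (AdicCompletion (IsLocalRing.maximalIdeal R) R)
  /-- residually rational: all residue fields of the integral closure of `R` in `Q` are equal to
  the residue field of `R` -/
  residuallyRational : ∀ n : Ideal (integralClosure R Q), n.IsMaximal →
    Function.Surjective
      ((Ideal.Quotient.mk n).comp (algebraMap R (integralClosure R Q)))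
  /-- the residue field has at least as many elements as there are valuation rings -/
  largeResidueField :
    ENat.card (DiscreteValuationOver R Q) ≤ ENat.card (IsLocalRing.ResidueField R)

variable {R Q}

/-- A regular fractional ideal of `R`: an `R`-submodule `I` of `Q` with `d I ⊆ R` for some regular
`d ∈ R`, containing a regular element of `Q`. -/
def IsRegularFractionalIdeal (I : Submodule R Q) : Prop :=
  IsFractional R⁰ I ∧ ∃ x ∈ I, x ∈ Q⁰

/-- The value vector `v(h) = (v_1(h), …, v_r(h))` of a regular element `h` of `Q`, in additive
notation; the components are indexed by the discrete valuation rings of `Q` over `R`. -/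
def valueVec (h : Q) : DiscreteValuationOver R Q → ℤ :=
  fun v => -WithZero.log (v.1 h)

/-- The value set `E(I)`, the set of values of the regular elements of `I`. -/
def valueSet (I : Submodule R Q) : Set (DiscreteValuationOver R Q → ℤ) :=
  {α | ∃ h ∈ I, h ∈ Q⁰ ∧ valueVec h = α}

/-- `ρ_J(I, α) = p(E(I), α) + q(E(J : I), 𝔣(J) - α) - 1`. The ideal quotient
`J : I = {x ∈ Q | x I ⊆ J}` is written `J / I`. -/
def rhoInv (J I : Submodule R Q) (α : DiscreteValuationOver R Q → ℤ) : ℤ :=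
  (pInv (valueSet I) α : ℤ) +
    (qInv (valueSet (J / I)) (frobeniusVec (valueSet J) - α) : ℤ) - 1

end Rings

end

/-! ### One-dimensional noetherian local rings -/

section OneDimensional

open IsLocalRing

variable {R : Type*} [CommRing R] [IsLocalRing R] [IsNoetherianRing R]

/-! Under the two membership hypotheses both points are automatically maximal. Values add under
multiplication, so a point of `F_{i}(E(I), α)` plus `𝔣(J) - α` lies in `F_{i}(E(J), 𝔣(J))`. That
fiber is empty for every `i` (`IsAdmissibleRing.fiber_frobeniusVec_singleton`). Since `I ⊆ J : (J :
I)`, the same argument applies to `J : I`. The formulas for the type are the definition of `ρ`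
rearranged.

The emptiness is combinatorial: a point of `F_{i}(E(J), 𝔣(J))` would allow the `i`-th coordinate of
the conductor to drop by one. This uses that `E(J)` is bounded below, contains a translate of `ℕ^r`,
is closed under infima, and allows raising one large coordinate while keeping the others. The last
two properties come from linear combinations of elements with controlled cancellation, by residual
rationality; infima also need the large residue field.

All this needs finitely many valuations with independent uniformizers, hence a finite integral
closure. Finiteness is where analytic reducedness enters: if no power of `x` conducts the integral
closure into `R`, then the completion has a nonzero nilpotent
(`exists_pow_mul_mem_range_of_isIntegral`). -/

omit [IsNoetherianRing R] in
theorem eq_maximalIdeal_of_mem_nonZeroDivisors [Ring.KrullDimLE 1 R] {r : R} (hr : r ∈ R⁰)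
    {p : Ideal R} [p.IsPrime] (hp : r ∈ p) : p = maximalIdeal R := by
  rcases Ring.krullDimLE_one_iff.1 ‹_› p ‹_› with h | h
  · exact absurd hp (Set.disjoint_right.1
      (Ideal.disjoint_nonZeroDivisors_of_mem_minimalPrimes h) hr)
  · exact eq_maximalIdeal h

theorem exists_maximalIdeal_pow_le_span [Ring.KrullDimLE 1 R] {r : R} (hr : r ∈ R⁰) :
    ∃ n, maximalIdeal R ^ n ≤ Ideal.span {r} := by
  have h : maximalIdeal R ≤ (Ideal.span {r}).radical := by
    rw [Ideal.radical_eq_sInf]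
    refine le_sInf fun p hp => ?_
    have := hp.2
    exact (eq_maximalIdeal_of_mem_nonZeroDivisors hr
      (hp.1 (Ideal.mem_span_singleton_self r))).ge
  obtain ⟨n, hn⟩ := (Ideal.span {r}).exists_radical_pow_le_of_fg (IsNoetherian.noetherian _)
  exact ⟨n, (Ideal.pow_right_mono h n).trans hn⟩

theorem isArtinianRing_quotient_span [Ring.KrullDimLE 1 R] {r : R} (hr : r ∈ R⁰) :
    IsArtinianRing (R ⧸ Ideal.span {r}) := by
  by_cases hu : IsUnit r
  · have : Subsingleton (R ⧸ Ideal.span {r}) :=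
      Ideal.Quotient.subsingleton_iff.2 (Ideal.span_singleton_eq_top.2 hu)
    infer_instance
  refine quotient_artinian_of_mem_minimalPrimes_of_isLocalRing _ ⟨⟨inferInstance, ?_⟩, ?_⟩
  · rw [Ideal.span_singleton_le_iff_mem]
    exact hu
  · rintro p ⟨hp, hpr⟩ -
    exact (eq_maximalIdeal_of_mem_nonZeroDivisors hr (hpr (Ideal.mem_span_singleton_self r))).ge

omit [IsLocalRing R] [IsNoetherianRing R] in
theorem isArtinian_of_smul_eq_zero {N : Type*} [AddCommGroup N] [Module R N] [Module.Finite R N]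
    (r : R) [IsArtinianRing (R ⧸ Ideal.span {r})] (h : ∀ n : N, r • n = 0) : IsArtinian R N := by
  have ht : Module.IsTorsionBySet R N (Ideal.span {r} : Ideal R) := by
    rw [Module.isTorsionBySet_span_singleton_iff]
    exact fun n => h n
  let := ht.module
  have : IsScalarTower R (R ⧸ Ideal.span {r}) N := ht.isScalarTower
  have : Module.Finite (R ⧸ Ideal.span {r}) N := Module.Finite.of_restrictScalars_finite R _ N
  exact isArtinian_of_surjective_algebraMap (S := R) (R := R ⧸ Ideal.span {r})
    Ideal.Quotient.mk_surjective

omit [IsLocalRing R] [IsNoetherianRing R] in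
/-- If `N` contains `R` with a cokernel of finite length, then `N / x N` is not longer than
`R / x R`. -/
theorem length_quotient_range_smul_le {N : Type*} [AddCommGroup N] [Module R N] (f : R →ₗ[R] N)
    (x : R) (hx : IsSMulRegular N x) (hfin : Module.length R (N ⧸ LinearMap.range f) ≠ ⊤) :
    Module.length R (N ⧸ LinearMap.range (LinearMap.lsmul R N x)) ≤
      Module.length R (R ⧸ Ideal.span {x}) := by
  set X := LinearMap.range (LinearMap.lsmul R N x)
  set F := LinearMap.range f
  set P := F.map (LinearMap.lsmul R N x)
  have hPX : P ≤ X := LinearMap.map_le_range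
  have hPF : P ≤ F := by
    rintro _ ⟨y, hy, rfl⟩
    exact F.smul_mem x hy
  -- With `F` the image of `R`, compute along `xF ⊆ xN ⊆ N`: multiplication by `x` identifies `N/F`
  -- with `xN/xF`.
  have h1 : Module.length R (N ⧸ P) = Module.length R (N ⧸ F) + Module.length R (N ⧸ X) := by
    refine Module.length_eq_add_of_exact (F.mapQ P (LinearMap.lsmul R N x) ?_)
      (Submodule.factor hPX) ?_ (Submodule.factor_surjective hPX) ?_
    · exact Submodule.le_comap_map _ _
    · rw [← LinearMap.ker_eq_bot, LinearMap.ker_eq_bot']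
      intro m
      induction m using Submodule.Quotient.induction_on with | _ m
      rw [Submodule.mapQ_apply, Submodule.Quotient.mk_eq_zero, Submodule.Quotient.mk_eq_zero]
      rintro ⟨y, hy, hxy⟩
      rwa [← hx hxy]
    · intro m
      induction m using Submodule.Quotient.induction_on with | _ m
      rw [← Submodule.mkQ_apply, Submodule.factor_mk, Submodule.mkQ_apply,
        Submodule.Quotient.mk_eq_zero]
      constructor
      · rintro ⟨y, rfl⟩
        exact ⟨Submodule.Quotient.mk y, rfl⟩
      · rintro ⟨y, hy⟩
        induction y using Submodule.Quotient.induction_on with | _ y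
        rw [Submodule.mapQ_apply, Submodule.mkQ_apply, Submodule.Quotient.eq] at hy
        have := X.sub_mem (LinearMap.mem_range_self (LinearMap.lsmul R N x) y) (hPX hy)
        simpa using this
  -- Now along `xF ⊆ F ⊆ N`, where `F/xF` is a quotient of `R/xR`; the finite length of `N/F` then
  -- cancels.
  have h2 : Module.length R (N ⧸ P) ≤
      Module.length R (R ⧸ Ideal.span {x}) + Module.length R (N ⧸ F) := by
    have hle : Ideal.span {x} ≤ P.comap f := by
      rw [Ideal.span_singleton_le_iff_mem]
      exact ⟨f 1, ⟨1, rfl⟩, by simp [← map_smul]⟩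
    have hex := Module.length_eq_add_of_exact
      (LinearMap.range (Submodule.mapQ (Ideal.span {x}) P f hle)).subtype
      (Submodule.factor hPF) (Submodule.subtype_injective _) (Submodule.factor_surjective hPF) ?_
    · rw [hex]
      gcongr
      exact Module.length_le_of_surjective _ (LinearMap.surjective_rangeRestrict _)
    · intro m
      induction m using Submodule.Quotient.induction_on with | _ m
      rw [← Submodule.mkQ_apply, Submodule.factor_mk, Submodule.mkQ_apply,
        Submodule.Quotient.mk_eq_zero, Submodule.coe_subtype, Subtype.range_coe]
      constructor
      · rintro ⟨y, rfl⟩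
        exact ⟨Submodule.Quotient.mk y, rfl⟩
      · rintro ⟨y, hy⟩
        induction y using Submodule.Quotient.induction_on with | _ y
        rw [Submodule.mapQ_apply, Submodule.mkQ_apply, Submodule.Quotient.eq] at hy
        have := F.sub_mem (LinearMap.mem_range_self f y) (hPF hy)
        simpa using this
  rw [h1, add_comm] at h2
  exact (ENat.add_le_add_iff_right hfin).1 h2

-- By Nakayama the minimal number of generators is the dimension of `N/𝔪N`, a quotient of `N/xN`.
omit [IsNoetherianRing R] in
theorem spanFinrank_le_length_quotient {M : Type*} [AddCommGroup M] [Module R M]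
    (N : Submodule R M) (hN : N.FG) {x : R} (hx : x ∈ maximalIdeal R) :
    (N.spanFinrank : ℕ∞) ≤ Module.length R (N ⧸ LinearMap.range (LinearMap.lsmul R N x)) := by
  have : Module.Finite R N := Module.Finite.iff_fg.2 hN
  have hle : LinearMap.range (LinearMap.lsmul R N x) ≤ maximalIdeal R • (⊤ : Submodule R N) := by
    rintro _ ⟨y, rfl⟩
    exact Submodule.smul_mem_smul hx trivial
  refine le_trans ?_ (Module.length_le_of_surjective (Submodule.factor hle)
    (Submodule.factor_surjective hle))
  let : Field (R ⧸ maximalIdeal R) := Ideal.Quotient.field _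
  have : Module.Finite (R ⧸ maximalIdeal R) (N ⧸ maximalIdeal R • (⊤ : Submodule R N)) :=
    Module.Finite.of_restrictScalars_finite R _ _
  rw [Module.length_eq_of_surjective (R := R ⧸ maximalIdeal R) (S := R)
    Ideal.Quotient.mk_surjective, Module.length_eq_finrank,
    IsLocalRing.spanFinrank_eq_finrank_quotient N hN]

variable {Q : Type*} [CommRing Q] [Algebra R Q] [IsFractionRing R Q]

omit [IsLocalRing R] [IsNoetherianRing R] in
theorem exists_smul_mem_range_of_fg (N : Submodule R Q) (hN : N.FG) :
    ∃ d ∈ R⁰, ∀ n ∈ N, ∃ a : R, algebraMap R Q a = d • n := by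
  obtain ⟨S, rfl⟩ := hN
  obtain ⟨d, hd⟩ := IsLocalization.exist_integer_multiples_of_finset R⁰ S
  refine ⟨d, d.2, fun n hn => ?_⟩
  induction hn using Submodule.span_induction with
  | mem y hy => exact hd y hy
  | zero => exact ⟨0, by simp⟩
  | add y z _ _ hy hz =>
    obtain ⟨a, ha⟩ := hy
    obtain ⟨b, hb⟩ := hz
    exact ⟨a + b, by simp [ha, hb]⟩
  | smul r y _ hy =>
    obtain ⟨a, ha⟩ := hy
    exact ⟨r * a, by rw [map_mul, ha, Algebra.smul_def, Algebra.smul_def, Algebra.smul_def]; ring⟩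

/-- Elements of the total ring of fractions that are integral over `R` satisfy equations of
bounded degree. -/
theorem exists_monic_natDegree_le_of_isIntegral [Ring.KrullDimLE 1 R] {x : R}
    (hx : x ∈ maximalIdeal R) (hx0 : x ∈ R⁰) {s : Q} (hs : IsIntegral R s) :
    ∃ p : Polynomial R, p.Monic ∧ p.natDegree ≤ (Module.length R (R ⧸ Ideal.span {x})).toNat ∧
      Polynomial.aeval s p = 0 := by
  set A := Algebra.adjoin R {s}
  have hfg : A.toSubmodule.FG := hs.fg_adjoin_singleton
  have : Module.Finite R A := Module.Finite.iff_fg.2 hfg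
  -- Cayley–Hamilton for multiplication by `s` on `R[s]`: the degree is the minimal number of
  -- generators of `R[s]`, which the two length estimates bound independently of `s`.
  obtain ⟨p, hp, hdeg, h0⟩ := LinearMap.exists_monic_and_natDegree_eq_and_aeval_eq_zero R
    (Algebra.lmul R A ⟨s, Algebra.self_mem_adjoin_singleton R s⟩)
  refine ⟨p, hp, ?_, ?_⟩
  · have := isArtinianRing_quotient_span hx0
    have hfinx : Module.length R (R ⧸ Ideal.span {x}) ≠ ⊤ := by
      have : IsArtinian R (R ⧸ Ideal.span {x}) :=
        isArtinian_of_surjective_algebraMap (S := R) (R := R ⧸ Ideal.span {x})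
          Ideal.Quotient.mk_surjective
      exact Module.length_ne_top
    have hreg : IsSMulRegular A x := by
      intro a b hab
      have h := congrArg Subtype.val hab
      simp only [Algebra.smul_def] at h
      exact Subtype.ext ((IsLocalization.map_units Q (⟨x, hx0⟩ : R⁰)).mul_left_cancel h)
    obtain ⟨d, hd, hdA⟩ := exists_smul_mem_range_of_fg A.toSubmodule hfg
    have hfin : Module.length R (A ⧸ LinearMap.range (Algebra.linearMap R A)) ≠ ⊤ := by
      have := isArtinianRing_quotient_span hd
      have : IsArtinian R (A ⧸ LinearMap.range (Algebra.linearMap R A)) := by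
        refine isArtinian_of_smul_eq_zero d fun n => ?_
        induction n using Submodule.Quotient.induction_on with | _ n
        rw [← Submodule.Quotient.mk_smul, Submodule.Quotient.mk_eq_zero]
        obtain ⟨a, ha⟩ := hdA n n.2
        exact ⟨a, Subtype.ext ha⟩
      exact Module.length_ne_top
    have h1 := length_quotient_range_smul_le (Algebra.linearMap R A) x hreg hfin
    have h2 := spanFinrank_le_length_quotient A.toSubmodule hfg hx
    rw [hdeg, ← ENat.natCast_le_natCast, ENat.natCast_toNat hfinx]
    refine le_trans (le_of_eq ?_) (h2.trans h1)
    exact congrArg _ (Submodule.spanFinrank_top A.toSubmodule)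
  · rw [Polynomial.aeval_algHom_apply] at h0
    have h1 : Polynomial.aeval (⟨s, Algebra.self_mem_adjoin_singleton R s⟩ : A) p = 0 := by
      simpa using congrArg (fun f => f 1) h0
    have h2 := congrArg A.val h1
    rwa [← Polynomial.aeval_algHom_apply, map_zero] at h2

/-- Scaling the roots of a monic equation for `s` by `x ^ n` gives one for `a` whose lower
coefficients are all divisible by `x ^ n`. The exponent depends neither on `s` nor on `n`. -/
theorem dvd_pow_of_isIntegral [Ring.KrullDimLE 1 R] {x : R}
    (hx : x ∈ maximalIdeal R) (hx0 : x ∈ R⁰) {s : Q} (hs : IsIntegral R s) {a : R} {n : ℕ}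
    (ha : algebraMap R Q a = algebraMap R Q (x ^ n) * s) :
    x ^ n ∣ a ^ (Module.length R (R ⧸ Ideal.span {x})).toNat := by
  obtain ⟨p, hp, hdeg, h0⟩ := exists_monic_natDegree_le_of_isIntegral hx hx0 hs
  refine dvd_trans ?_ (pow_dvd_pow a hdeg)
  have h := Polynomial.scaleRoots_aeval_eq_zero (r := x ^ n) h0
  rw [← ha, Polynomial.aeval_algebraMap_apply, Polynomial.coe_aeval_eq_eval] at h
  replace h := (IsFractionRing.injective R Q) (h.trans (map_zero _).symm)
  rw [Polynomial.eval_eq_sum_range, Finset.sum_range_succ, Polynomial.natDegree_scaleRoots,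
    Polynomial.coeff_scaleRoots_natDegree, hp.leadingCoeff, one_mul, add_comm] at h
  rw [eq_neg_of_add_eq_zero_left h, dvd_neg]
  refine Finset.dvd_sum fun i hi => ?_
  rw [Polynomial.coeff_scaleRoots]
  exact ((dvd_pow_self _ (Nat.sub_ne_zero_of_lt (Finset.mem_range.1 hi))).mul_left _).mul_right _

/-- The integral closure of an analytically reduced one-dimensional local ring is conducted into
the ring by a power of any given regular element. -/
theorem exists_pow_mul_mem_range_of_isIntegral [Ring.KrullDimLE 1 R]
    [IsReduced (AdicCompletion (maximalIdeal R) R)] {x : R}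
    (hx : x ∈ maximalIdeal R) (hx0 : x ∈ R⁰) :
    ∃ n, ∀ s : Q, IsIntegral R s → ∃ a, algebraMap R Q a = algebraMap R Q (x ^ n) * s := by
  -- `a n` consists of the elements of `R` that are divisible by `x ^ n` in the integral closure
  let a (n : ℕ) : Ideal R :=
    { carrier := {b | ∃ s : Q, IsIntegral R s ∧ algebraMap R Q b = algebraMap R Q (x ^ n) * s}
      zero_mem' := ⟨0, isIntegral_zero, by simp⟩
      add_mem' := by
        rintro _ _ ⟨s, hs, h⟩ ⟨t, ht, h'⟩
        exact ⟨s + t, hs.add ht, by rw [map_add, h, h', mul_add]⟩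
      smul_mem' := by
        rintro c _ ⟨s, hs, h⟩
        exact ⟨algebraMap R Q c * s, isIntegral_algebraMap.mul hs, by
          rw [smul_eq_mul, map_mul, h]; ring⟩ }
  have ha : Antitone a := by
    rintro m n hmn b ⟨s, hs, h⟩
    refine ⟨algebraMap R Q (x ^ (n - m)) * s, isIntegral_algebraMap.mul hs, ?_⟩
    rw [h, ← mul_assoc, ← map_mul, ← pow_add, Nat.add_sub_cancel' hmn]
  have hxu : ∀ k, IsUnit (algebraMap R Q (x ^ k)) := fun k =>
    IsLocalization.map_units Q (⟨x ^ k, pow_mem hx0 k⟩ : R⁰)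
  by_cases hc : ∃ n, a n ≤ Ideal.span {x}
  · obtain ⟨n, hn⟩ := hc
    refine ⟨n, fun s hs => ?_⟩
    -- An element of `a n` is divisible by `x` in `R`, so surplus factors of `x` can be cancelled
    -- one by one.
    have key : ∀ k, (∃ b, algebraMap R Q b = algebraMap R Q (x ^ (n + k)) * s) →
        ∃ b, algebraMap R Q b = algebraMap R Q (x ^ n) * s := by
      intro k
      induction k with
      | zero => exact id
      | succ k ih =>
        rintro ⟨b, hb⟩
        have hmem : b ∈ a n := ha (by lia : n ≤ n + (k + 1)) ⟨s, hs, hb⟩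
        obtain ⟨c, rfl⟩ := Ideal.mem_span_singleton.1 (hn hmem)
        refine ih ⟨c, (hxu 1).mul_left_cancel ?_⟩
        rw [← mul_assoc, ← map_mul, ← map_mul, ← pow_add, pow_one, hb]
        ring_nf
    obtain ⟨b, d, rfl⟩ := IsLocalization.exists_mk'_eq R⁰ s
    obtain ⟨m, hm⟩ := exists_maximalIdeal_pow_le_span d.2
    obtain ⟨c, hc⟩ := Ideal.mem_span_singleton.1 (hm (Ideal.pow_mem_pow hx m))
    refine key m ⟨x ^ n * c * b, ?_⟩
    rw [pow_add, hc, mul_comm (d : R) c, map_mul, ← mul_assoc, map_mul _ (x ^ n * c),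
      mul_assoc, IsLocalization.mk'_spec']
  · exfalso
    push Not at hc
    -- `R/(x ^ k)` is artinian, so the decreasing images of the `a n` stabilize there. This permits
    -- lifting `z₀ ∉ (x)` successively into deeper `a n`, as in Chevalley's theorem.
    have hst : ∀ k, ∃ m, k ≤ m ∧ ∀ n, m ≤ n →
        a n ⊔ Ideal.span {x ^ k} = a m ⊔ Ideal.span {x ^ k} := by
      intro k
      have := isArtinianRing_quotient_span (pow_mem hx0 k)
      obtain ⟨m, hm⟩ := IsArtinian.monotone_stabilizes (R := R ⧸ Ideal.span {x ^ k})
        (M := R ⧸ Ideal.span {x ^ k})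
        ⟨fun n => OrderDual.toDual ((a n).map (Ideal.Quotient.mk (Ideal.span {x ^ k}))),
          fun i j hij => Ideal.map_mono (ha hij)⟩
      have hm' : ∀ n, m ≤ n → a n ⊔ Ideal.span {x ^ k} = a m ⊔ Ideal.span {x ^ k} := by
        intro n hn
        have h : (a m).map (Ideal.Quotient.mk (Ideal.span {x ^ k})) =
            (a n).map (Ideal.Quotient.mk (Ideal.span {x ^ k})) := hm n hn
        simpa [Ideal.comap_map_of_surjective' _ Ideal.Quotient.mk_surjective] using
          (congrArg (Ideal.comap (Ideal.Quotient.mk (Ideal.span {x ^ k}))) h).symm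
      exact ⟨m + k, by lia, fun n hn => by rw [hm' n (by lia), hm' (m + k) (by lia)]⟩
    choose N hkN hN using hst
    obtain ⟨z₀, hz₀, hz₀x⟩ := SetLike.not_le_iff_exists.1 (hc (N 1))
    have step : ∀ k, ∀ z : R, z ∈ a (N (k + 1)) →
        ∃ w ∈ a (N (k + 1 + 1)), x ^ (k + 1) ∣ z - w := by
      intro k z hz
      have h1 : z ∈ a (N (k + 1)) ⊔ Ideal.span {x ^ (k + 1)} := Ideal.mem_sup_left hz
      rw [← hN (k + 1) _ (le_max_left (N (k + 1)) (N (k + 1 + 1)))] at h1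
      obtain ⟨w, hw, y, hy, rfl⟩ := Submodule.mem_sup.1 h1
      exact ⟨w, ha (le_max_right _ _) hw, by simpa using Ideal.mem_span_singleton.1 hy⟩
    choose! g hg hgx using step
    let z : ℕ → R := fun k => Nat.rec z₀ g k
    have hz : ∀ k, z k ∈ a (N (k + 1)) := by
      intro k
      induction k with
      | zero => exact hz₀
      | succ k ih => exact hg k _ ih
    have hzx : ∀ k, x ^ (k + 1) ∣ z k - z (k + 1) := fun k => hgx k _ (hz k)
    have hpow : ∀ {k b}, x ^ k ∣ b → b ∈ (maximalIdeal R ^ k • ⊤ : Ideal R) := by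
      intro k b hb
      rw [smul_eq_mul, Ideal.mul_top]
      exact Ideal.mem_of_dvd _ hb (Ideal.pow_mem_pow hx k)
    let Z : AdicCompletion.AdicCauchySequence (maximalIdeal R) R :=
      AdicCompletion.AdicCauchySequence.mk _ _ z fun k => by
        rw [SModEq.sub_mem]
        exact hpow ((pow_dvd_pow x k.le_succ).trans (hzx k))
    -- The `k`-th term lies in `a k`, so one fixed power of it is divisible by `x ^ k`, for every
    -- `k`.
    have hnil : IsNilpotent (AdicCompletion.mkₐ (maximalIdeal R) Z) := by
      refine ⟨(Module.length R (R ⧸ Ideal.span {x})).toNat, ?_⟩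
      refine AdicCompletion.ext_evalₐ (I := maximalIdeal R) fun k => ?_
      obtain ⟨s, hs, h⟩ := ha ((Nat.le_succ k).trans (hkN (k + 1))) (hz k)
      rw [map_pow, AdicCompletion.evalₐ_mkₐ, map_zero, ← map_pow, Ideal.Quotient.eq_zero_iff_mem]
      exact Ideal.mem_of_dvd _ (dvd_pow_of_isIntegral hx hx0 hs h) (Ideal.pow_mem_pow hx k)
    -- If the limit vanished, some `z m` would lie in `(x)`; but every `z m` is congruent to `z₀`
    -- modulo `x`.
    obtain ⟨m, hm⟩ := exists_maximalIdeal_pow_le_span hx0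
    have h0 := congrArg (AdicCompletion.evalₐ (maximalIdeal R) m) hnil.eq_zero
    rw [AdicCompletion.evalₐ_mkₐ, map_zero, Ideal.Quotient.eq_zero_iff_mem] at h0
    have hsub : ∀ k, x ∣ z₀ - z k := by
      intro k
      induction k with
      | zero => exact ⟨0, by simp [z]⟩
      | succ k ih => simpa using ih.add ((dvd_pow_self x k.succ_ne_zero).trans (hzx k))
    refine hz₀x ?_
    have := (Ideal.span {x}).add_mem (Ideal.mem_span_singleton.2 (hsub m)) (hm h0)
    rwa [AdicCompletion.AdicCauchySequence.mk_coe, sub_add_cancel] at this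

end OneDimensional

/-! ### The total ring of fractions and the integral closure -/

section IntegralClosure

open IsLocalRing

theorem isUnit_of_mem_nonZeroDivisors_of_isFractionRing (R : Type*) [CommRing R] {Q : Type*}
    [CommRing Q] [Algebra R Q] [IsFractionRing R Q] {q : Q} (hq : q ∈ Q⁰) : IsUnit q := by
  obtain ⟨a, d, rfl⟩ := IsLocalization.exists_mk'_eq R⁰ q
  have ha : algebraMap R Q a ∈ Q⁰ := by
    rw [← IsLocalization.mk'_spec Q a d]
    exact mul_mem hq (IsLocalization.map_units Q d).mem_nonZeroDivisors
  have ha' : a ∈ R⁰ := by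
    rw [mem_nonZeroDivisors_iff_right] at ha ⊢
    intro b hb
    refine IsFractionRing.injective R Q ?_
    rw [map_zero]
    exact ha _ (by rw [← map_mul, hb, map_zero])
  have h := IsLocalization.map_units Q (⟨a, ha'⟩ : R⁰)
  rw [← IsLocalization.mk'_spec Q a d] at h
  exact isUnit_of_mul_isUnit_left h

variable {R : Type*} [CommRing R] {Q : Type*} [CommRing Q] [Algebra R Q] [IsFractionRing R Q]

theorem isUnit_algebraMap_of_mem_nonZeroDivisors {d : R} (hd : d ∈ R⁰) :
    IsUnit (algebraMap R Q d) :=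
  IsLocalization.map_units Q (⟨d, hd⟩ : R⁰)

theorem Submodule.fg_of_smul_mem_range [IsNoetherianRing R] (N : Submodule R Q) {d : R}
    (hd : d ∈ R⁰) (h : ∀ n ∈ N, ∃ a, algebraMap R Q a = algebraMap R Q d * n) : N.FG := by
  obtain ⟨u, hu⟩ := isUnit_algebraMap_of_mem_nonZeroDivisors (Q := Q) hd
  have hle : N ≤ Submodule.span R {(↑u⁻¹ : Q)} := by
    intro n hn
    obtain ⟨a, ha⟩ := h n hn
    refine Submodule.mem_span_singleton.2 ⟨a, ?_⟩
    rw [Algebra.smul_def, ha, ← hu, mul_comm, Units.inv_mul_cancel_left]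
  have : IsNoetherian R (Submodule.span R {(↑u⁻¹ : Q)}) :=
    isNoetherian_span_of_finite R (Set.finite_singleton _)
  have := isNoetherian_of_le hle
  exact Module.Finite.iff_fg.1 inferInstance

theorem isIntegral_of_mul_pow_mem_range [IsNoetherianRing R] {q : Q} {d : R} (hd : d ∈ R⁰)
    (h : ∀ k, ∃ a, algebraMap R Q a = algebraMap R Q d * q ^ k) : IsIntegral R q := by
  refine IsIntegral.of_mem_of_fg (Algebra.adjoin R {q}) ?_ q (Algebra.self_mem_adjoin_singleton R q)
  refine Submodule.fg_of_smul_mem_range _ hd fun n hn => ?_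
  rw [Subalgebra.mem_toSubmodule, Algebra.adjoin_singleton_eq_range_aeval] at hn
  obtain ⟨p, rfl⟩ := hn
  change ∃ a, _ = _ * Polynomial.aeval q p
  rw [Polynomial.aeval_eq_sum_range, Finset.mul_sum]
  choose a ha using h
  refine ⟨∑ i ∈ Finset.range (p.natDegree + 1), p.coeff i * a i, ?_⟩
  rw [map_sum]
  refine Finset.sum_congr rfl fun i _ => ?_
  rw [map_mul, ha, Algebra.smul_def]
  ring

variable (R Q) in
theorem isFractionRing_integralClosure : IsFractionRing (integralClosure R Q) Q where
  map_units s := by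
    refine isUnit_of_mem_nonZeroDivisors_of_isFractionRing R
      (mem_nonZeroDivisors_iff_right.2 fun q hq => ?_)
    obtain ⟨a, d, rfl⟩ := IsLocalization.exists_mk'_eq R⁰ q
    have h : algebraMap R (integralClosure R Q) a = 0 := by
      refine mem_nonZeroDivisors_iff_right.1 s.2 _ (Subtype.ext ?_)
      change algebraMap R Q a * _ = 0
      rw [← IsLocalization.mk'_spec' Q a d, mul_assoc]
      exact (congrArg _ hq).trans (mul_zero _)
    have h' : algebraMap R Q a = 0 := congrArg Subtype.val h
    refine (isUnit_algebraMap_of_mem_nonZeroDivisors (Q := Q) d.2).mul_left_cancel ?_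
    rw [IsLocalization.mk'_spec' Q a d, h', mul_zero]
  surj q := by
    obtain ⟨a, d, rfl⟩ := IsLocalization.exists_mk'_eq R⁰ q
    refine ⟨⟨algebraMap R _ a, algebraMap R _ (d : R), ?_⟩, IsLocalization.mk'_spec Q a d⟩
    refine mem_nonZeroDivisors_iff_right.2 fun s hs => Subtype.ext ?_
    refine (isUnit_algebraMap_of_mem_nonZeroDivisors (Q := Q) d.2).mul_right_cancel ?_
    exact (congrArg Subtype.val hs).trans (zero_mul _).symm
  exists_of_eq h := ⟨1, by rw [Subtype.ext h]⟩

variable [IsLocalRing R] [IsNoetherianRing R]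

/-- For regular `h` and any `q`, all but finitely many of the elements `q + x ^ n h` are regular. -/
theorem exists_ge_add_pow_mul_mem_nonZeroDivisors {x : R} (hx : x ∈ maximalIdeal R) (hx0 : x ∈ R⁰)
    {h : Q} (hh : h ∈ Q⁰) (q : Q) (N : ℕ) :
    ∃ n, N ≤ n ∧ q + algebraMap R Q (x ^ n) * h ∈ Q⁰ := by
  by_contra! hc
  have : IsNoetherianRing Q := IsLocalization.isNoetherianRing R⁰ Q inferInstance
  -- Zero divisors fill the finitely many associated primes, so two of these elements would share
  -- one; their difference is a unit of `Q`.
  have hmem : ∀ n, ∃ p ∈ associatedPrimes Q Q, q + algebraMap R Q (x ^ (N + n)) * h ∈ p := by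
    intro n
    have h1 : q + algebraMap R Q (x ^ (N + n)) * h ∈ (Q⁰ : Set Q)ᶜ := hc _ (Nat.le_add_right N n)
    rw [← biUnion_associatedPrimes_eq_compl_nonZeroDivisors] at h1
    simpa using h1
  choose p hp hpmem using hmem
  have : Finite (associatedPrimes Q Q) := (associatedPrimes.finite Q Q).to_subtype
  obtain ⟨i, j, hij, he⟩ := Finite.exists_ne_map_eq_of_infinite
    (fun n => (⟨p n, hp n⟩ : associatedPrimes Q Q))
  wlog hlt : i < j generalizing i j
  · exact this j i hij.symm he.symm (by lia)
  have hpe : p i = p j := congrArg Subtype.val he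
  have hprime : (p i).IsPrime := (hp i).isPrime
  have hsub := (p i).sub_mem (hpmem i) (hpe ▸ hpmem j)
  have hu : IsUnit (1 - x ^ (j - i)) :=
    isUnit_one_sub_self_of_mem_nonunits _ (Ideal.pow_mem_of_mem _ hx _ (by lia))
  have heq : q + algebraMap R Q (x ^ (N + i)) * h - (q + algebraMap R Q (x ^ (N + j)) * h) =
      algebraMap R Q (x ^ (N + i)) * algebraMap R Q (1 - x ^ (j - i)) * h := by
    rw [map_sub, map_one, mul_sub, ← map_mul, ← pow_add, mul_one, sub_mul,
      show N + i + (j - i) = N + j by lia]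
    ring
  rw [heq] at hsub
  exact hprime.ne_top (Ideal.eq_top_of_isUnit_mem _ hsub
    (((isUnit_algebraMap_of_mem_nonZeroDivisors (pow_mem hx0 _)).mul (hu.map _)).mul
      (isUnit_of_mem_nonZeroDivisors_of_isFractionRing R hh)))

/-- The maximal ideals of a module-finite integral closure are generated by regular elements. -/
theorem exists_eq_span_singleton_of_isMaximal [Ring.KrullDimLE 1 R]
    {x : R} (hx : x ∈ maximalIdeal R) (hx0 : x ∈ R⁰)
    (hc : ∃ n, ∀ s : Q, IsIntegral R s → ∃ a, algebraMap R Q a = algebraMap R Q (x ^ n) * s)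
    (n : Ideal (integralClosure R Q)) (hn : n.IsMaximal) :
    ∃ t : integralClosure R Q, (t : Q) ∈ Q⁰ ∧ n = Ideal.span {t} := by
  obtain ⟨c, hc⟩ := hc
  let S := integralClosure R Q
  have hfrac : IsFractionRing S Q := isFractionRing_integralClosure R Q
  have hfin : Module.Finite R S := Module.Finite.iff_fg.2
    (Submodule.fg_of_smul_mem_range S.toSubmodule (pow_mem hx0 c) hc)
  have hnoeth : IsNoetherianRing S := IsNoetherianRing.of_finite R S
  have hcomap : ∀ p : Ideal S, p.IsMaximal → p.comap (algebraMap R S) = maximalIdeal R :=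
    fun p hp => eq_maximalIdeal (Ideal.isMaximal_comap_of_isIntegral_of_isMaximal p)
  have hfinmax : {p : Ideal S | p.IsMaximal}.Finite := by
    refine (Algebra.QuasiFinite.finite_primesOver (S := S) (maximalIdeal R)).subset fun p hp => ?_
    exact ⟨hp.isPrime, ⟨(hcomap p hp).symm⟩⟩
  set y : S := algebraMap R S x
  have hyu : IsUnit (y : Q) := isUnit_algebraMap_of_mem_nonZeroDivisors hx0
  have hyn : y ∈ n := by
    have : x ∈ n.comap (algebraMap R S) := (hcomap n hn).symm ▸ hx
    exact this
  -- `n` is minimal over `y`, so `n = (y : z)` for some `z`; then `z / y` multiplies `n` into `S`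
  -- but is not in `S`.
  have hass : n ∈ associatedPrimes S (S ⧸ Ideal.span {y}) := by
    refine Module.associatedPrimes.minimalPrimes_annihilator_subset_associatedPrimes _ _ ?_
    rw [Ideal.annihilator_quotient]
    refine ⟨⟨inferInstance, by rwa [Ideal.span_singleton_le_iff_mem]⟩, ?_⟩
    rintro p ⟨hp, hyp⟩ hpn
    have hpx : p.comap (algebraMap R S) = maximalIdeal R :=
      eq_maximalIdeal_of_mem_nonZeroDivisors hx0 (hyp (Ideal.mem_span_singleton_self y))
    have : p.IsMaximal := Ideal.isMaximal_of_isIntegral_of_isMaximal_comap (R := R) p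
      (hpx ▸ maximalIdeal.isMaximal R)
    exact (this.eq_of_le (Ideal.IsPrime.ne_top inferInstance) hpn).ge
  -- The candidate inverse `S : n` of `n`.
  let J : Submodule S Q :=
    { carrier := {q | ∀ s ∈ n, ∃ b : S, (b : Q) = q * s}
      zero_mem' := fun s _ => ⟨0, by simp⟩
      add_mem' := by
        intro q q' hq hq' s hs
        obtain ⟨b, hb⟩ := hq s hs
        obtain ⟨b', hb'⟩ := hq' s hs
        exact ⟨b + b', by rw [Subalgebra.coe_add, hb, hb', add_mul]⟩
      smul_mem' := by
        intro r q hq s hs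
        obtain ⟨b, hb⟩ := hq s hs
        exact ⟨r * b, by rw [Subalgebra.coe_mul, hb, Subalgebra.smul_def, smul_eq_mul, mul_assoc]⟩ }
  have hJ1 : (1 : Q) ∈ J := fun s _ => ⟨s, (one_mul _).symm⟩
  have hJfrac : IsFractional S⁰ J := by
    refine ⟨y, ?_, fun q hq => ?_⟩
    · refine mem_nonZeroDivisors_iff_right.2 fun s hs => Subtype.ext (hyu.mul_right_cancel ?_)
      exact (congrArg Subtype.val hs).trans (zero_mul _).symm
    · obtain ⟨b, hb⟩ := hq y hyn
      exact ⟨b, hb.trans (mul_comm _ _)⟩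
  have hnJ : IsLocalization.coeSubmodule Q n * J = 1 := by
    refine le_antisymm (Submodule.mul_le.2 ?_) ?_
    · rintro _ ⟨s, hs, rfl⟩ q hq
      obtain ⟨b, hb⟩ := hq s hs
      exact Submodule.mem_one.2 ⟨b, hb.trans (mul_comm _ _)⟩
    · let a : Ideal S := (IsLocalization.coeSubmodule Q n * J).comap (Algebra.linearMap S Q)
      have hna : n ≤ a := fun s hs => by
        have := Submodule.mul_mem_mul (M := IsLocalization.coeSubmodule Q n) ⟨s, hs, rfl⟩ hJ1
        rwa [mul_one] at this
      -- `n ⊆ nJ ⊆ S`, so otherwise `nJ = n`. Then the powers of each `q ∈ J` have a common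
      -- denominator, so `q` is integral; for `q = z / y` this is a contradiction.
      have hatop : a = ⊤ := by
        by_contra hne
        have han : n = a := hn.eq_of_le hne hna
        have hJn : ∀ q ∈ J, ∀ s ∈ n, ∃ b ∈ n, (b : Q) = q * s := by
          intro q hq s hs
          obtain ⟨b, hb⟩ := hq s hs
          refine ⟨b, han ▸ ?_, hb⟩
          have := Submodule.mul_mem_mul (M := IsLocalization.coeSubmodule Q n) ⟨s, hs, rfl⟩ hq
          rw [show (Algebra.linearMap S Q) s * q = b from (mul_comm _ _).trans hb.symm] at this
          exact Submodule.mem_comap.2 this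
        have hJint : ∀ q ∈ J, IsIntegral R q := by
          intro q hq
          have hpow : ∀ k, ∃ b ∈ n, (b : Q) = algebraMap R Q x * q ^ k := by
            intro k
            induction k with
            | zero => exact ⟨y, hyn, by rw [pow_zero, mul_one]; rfl⟩
            | succ k ih =>
              obtain ⟨b, hb, hbq⟩ := ih
              obtain ⟨b', hb', h⟩ := hJn q hq b hb
              exact ⟨b', hb', by rw [h, hbq]; ring⟩
          refine isIntegral_of_mul_pow_mem_range (pow_mem hx0 (c + 1)) fun k => ?_
          obtain ⟨b, -, hbq⟩ := hpow k
          obtain ⟨e, he⟩ := hc b b.2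
          exact ⟨e, by rw [he, hbq, pow_succ, map_mul, mul_assoc]⟩
        obtain ⟨-, z, hz⟩ := isAssociatedPrime_iff.1 hass
        obtain ⟨z, rfl⟩ := Ideal.Quotient.mk_surjective z
        obtain ⟨u, hu⟩ := hyu
        have hzJ : (↑u⁻¹ : Q) * z ∈ J := by
          intro s hs
          rw [hz, Submodule.mem_colon_singleton, Submodule.mem_bot, ← Ideal.Quotient.mk_eq_mk,
            ← Submodule.Quotient.mk_smul,
            Ideal.Quotient.mk_eq_mk, smul_eq_mul, Ideal.Quotient.eq_zero_iff_mem,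
            Ideal.mem_span_singleton] at hs
          obtain ⟨b, hb⟩ := hs
          refine ⟨b, ?_⟩
          have hb' : (s : Q) * z = y * b := congrArg Subtype.val hb
          rw [mul_assoc, mul_comm (z : Q), hb', ← hu, Units.inv_mul_cancel_left]
        have hzy : z = y * ⟨_, hJint _ hzJ⟩ := by
          refine Subtype.ext ?_
          rw [Subalgebra.coe_mul, ← hu, Units.mul_inv_cancel_left]
        refine hn.ne_top (hz.trans ?_)
        rw [Ideal.Quotient.eq_zero_iff_mem.2
          (Ideal.mem_span_singleton.2 ⟨_, hzy⟩)]
        exact (Ideal.eq_top_iff_one _).2 (Submodule.mem_colon_singleton.2 (smul_zero _))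
      rw [Submodule.one_le]
      have : (1 : S) ∈ a := hatop ▸ Submodule.mem_top
      exact this
  -- An invertible ideal of a ring with finitely many maximal ideals is principal.
  have hprin := FractionalIdeal.isPrincipal.of_finite_maximals_of_inv (le_refl S⁰) hfinmax
    (n : FractionalIdeal S⁰ Q) (⟨J, hJfrac⟩ : FractionalIdeal S⁰ Q)
    (FractionalIdeal.coeToSubmodule_injective ((FractionalIdeal.coe_mul _ _).trans
      (hnJ.trans FractionalIdeal.coe_one.symm)))
  rw [FractionalIdeal.coe_coeIdeal, IsLocalization.coeSubmodule_isPrincipal _ (le_refl S⁰)] at hprin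
  obtain ⟨t, ht⟩ := hprin
  refine ⟨t, ?_, ht⟩
  rw [ht] at hyn
  obtain ⟨b, hb⟩ := Ideal.mem_span_singleton.1 hyn
  rw [hb, Subalgebra.coe_mul] at hyu
  exact (isUnit_of_mul_isUnit_left hyu).mem_nonZeroDivisors

end IntegralClosure

/-! ### Discrete valuation rings of `Q` over `R` -/

section Valuations

open IsLocalRing

variable {R : Type*} [CommRing R] {Q : Type*} [CommRing Q] [Algebra R Q]

theorem DiscreteValuationOver.map_ne_zero_of_isUnit (v : DiscreteValuationOver R Q) {q : Q}
    (hq : IsUnit q) : v.1 q ≠ 0 :=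
  (hq.map v.1).ne_zero

theorem DiscreteValuationOver.map_le_one_of_isIntegral (v : DiscreteValuationOver R Q) {q : Q}
    (hq : IsIntegral R q) : v.1 q ≤ 1 := by
  refine (Valuation.integer.integers v.1).mem_of_integral (x := q) ?_
  obtain ⟨p, hp, h⟩ := hq
  refine ⟨p.map ((algebraMap R Q).codRestrict v.1.integer v.2.2), hp.map _, ?_⟩
  rw [Polynomial.eval₂_map]
  exact h

/-- The center of a discrete valuation on the integral closure. -/
def DiscreteValuationOver.center (v : DiscreteValuationOver R Q) :
    Ideal (integralClosure R Q) where
  carrier := {s | v.1 s < 1}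
  zero_mem' := by simp
  add_mem' hs ht := v.1.map_add_lt hs ht
  smul_mem' r s hs := by
    have h1 : v.1 r ≤ 1 := v.map_le_one_of_isIntegral r.2
    have h2 : v.1 s < 1 := hs
    change v.1 (r * s) < 1
    rw [map_mul]
    exact (mul_le_of_le_one_left' h1).trans_lt h2

theorem DiscreteValuationOver.mem_center {v : DiscreteValuationOver R Q}
    {s : integralClosure R Q} : s ∈ v.center ↔ v.1 s < 1 := Iff.rfl

instance DiscreteValuationOver.center_isPrime (v : DiscreteValuationOver R Q) :
    v.center.IsPrime where
  ne_top' := by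
    rw [Ne, Ideal.eq_top_iff_one, v.mem_center]
    simp
  mem_or_mem' {s t} h := by
    rw [v.mem_center, Subalgebra.coe_mul, map_mul] at h
    rw [v.mem_center, v.mem_center]
    by_contra! hc
    exact h.not_ge (one_le_mul hc.1 hc.2)

theorem WithZero.exists_pow_lt_of_lt_one {a b : ℤᵐ⁰} (ha : a < 1) (hb : b ≠ 0) :
    ∃ N, ∀ n, N ≤ n → a ^ n < b := by
  obtain rfl | ha0 := eq_or_ne a 0
  · exact ⟨1, fun n hn => by rw [zero_pow (by lia)]; exact zero_lt_iff.2 hb⟩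
  have hla : log a < 0 := by rwa [log_lt_iff_lt_exp ha0, exp_zero]
  refine ⟨(log b).natAbs + 1, fun n hn => ?_⟩
  rw [← log_lt_log (pow_ne_zero _ ha0) hb, log_pow, nsmul_eq_mul]
  have h1 : -(log b) ≤ (log b).natAbs := by lia
  have h2 : ((log b).natAbs : ℤ) + 1 ≤ n := by exact_mod_cast hn
  nlinarith

variable [IsFractionRing R Q] [IsLocalRing R] [IsNoetherianRing R] [Ring.KrullDimLE 1 R]

/-- Every regular `d` divides a power of `x`. If `v x = 1`, all denominators would have value one
and `v ≤ 1` on `Q`, against surjectivity. -/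
theorem DiscreteValuationOver.map_lt_one (v : DiscreteValuationOver R Q) {x : R}
    (hx : x ∈ maximalIdeal R) : v.1 (algebraMap R Q x) < 1 := by
  refine lt_of_le_of_ne (v.2.2 x) fun h1 => ?_
  obtain ⟨q, hq⟩ := v.2.1 (WithZero.exp 1)
  obtain ⟨a, d, rfl⟩ := IsLocalization.exists_mk'_eq R⁰ q
  obtain ⟨m, hm⟩ := exists_maximalIdeal_pow_le_span d.2
  obtain ⟨c, hc⟩ := Ideal.mem_span_singleton.1 (hm (Ideal.pow_mem_pow hx m))
  have hd : v.1 (algebraMap R Q d) = 1 := by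
    refine le_antisymm (v.2.2 d) ?_
    have h2 := congrArg (fun r => v.1 (algebraMap R Q r)) hc
    simp only [map_mul, map_pow, h1, one_pow] at h2
    exact h2.le.trans (mul_le_of_le_one_right' (v.2.2 c))
  have h3 := congrArg v.1 (IsLocalization.mk'_spec Q a d)
  rw [map_mul, hq, hd, mul_one] at h3
  have h4 := v.2.2 a
  rw [← h3, ← WithZero.exp_zero, WithZero.exp_le_exp] at h4
  lia

theorem DiscreteValuationOver.center_isMaximal (v : DiscreteValuationOver R Q) :
    v.center.IsMaximal := by
  refine Ideal.isMaximal_of_isIntegral_of_isMaximal_comap (R := R) v.center ?_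
  have h : maximalIdeal R ≤ v.center.comap (algebraMap R (integralClosure R Q)) :=
    fun x hx => v.map_lt_one hx
  rw [← (maximalIdeal.isMaximal R).eq_of_le (Ideal.IsPrime.ne_top inferInstance) h]
  exact maximalIdeal.isMaximal R

omit [IsFractionRing R Q] [IsLocalRing R] [IsNoetherianRing R] [Ring.KrullDimLE 1 R] in
theorem DiscreteValuationOver.exists_eq_pow_mul_of_center_eq_span (v : DiscreteValuationOver R Q)
    {t : integralClosure R Q} (ht : v.center = Ideal.span {t})
    {s : integralClosure R Q} (hs : v.1 s ≠ 0) :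
    ∃ m : ℕ, ∃ b : integralClosure R Q, s = t ^ m * b ∧ v.1 b = 1 := by
  have htc : v.1 t < 1 := v.mem_center.1 (ht ▸ Ideal.mem_span_singleton_self t)
  obtain ⟨N, hN⟩ := WithZero.exists_pow_lt_of_lt_one htc hs
  replace hN := (hN N le_rfl).le
  induction N generalizing s with
  | zero =>
    exact ⟨0, s, by simp, le_antisymm (v.map_le_one_of_isIntegral s.2) (by simpa using hN)⟩
  | succ N ih =>
    by_cases h1 : v.1 s < 1
    · obtain ⟨s', rfl⟩ := Ideal.mem_span_singleton.1 (ht ▸ v.mem_center.2 h1)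
      rw [Subalgebra.coe_mul, map_mul] at hs hN
      have ht0 := left_ne_zero_of_mul hs
      rw [pow_succ', mul_le_mul_iff_right₀ (zero_lt_iff.2 ht0)] at hN
      obtain ⟨m, b, rfl, hb⟩ := ih (right_ne_zero_of_mul hs) hN
      exact ⟨m + 1, b, by ring, hb⟩
    · exact ⟨0, s, by simp, le_antisymm (v.map_le_one_of_isIntegral s.2) (not_lt.1 h1)⟩

omit [IsLocalRing R] [IsNoetherianRing R] [Ring.KrullDimLE 1 R] in
/-- If the center of `v` is generated by `t`, then every regular element is, up to a quotient of
elements outside the center, a power of `t`. -/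
theorem DiscreteValuationOver.exists_mul_pow_mul_eq (v : DiscreteValuationOver R Q)
    {t : integralClosure R Q} (ht : v.center = Ideal.span {t}) {q : Q} (hq : v.1 q ≠ 0) :
    ∃ m l : ℕ, ∃ a b : integralClosure R Q, v.1 a = 1 ∧ v.1 b = 1 ∧
      q * (t ^ m * b) = t ^ l * a := by
  obtain ⟨a, d, rfl⟩ := IsLocalization.exists_mk'_eq R⁰ q
  have hspec := IsLocalization.mk'_spec Q a d
  have hd : v.1 (algebraMap R Q d) ≠ 0 :=
    v.map_ne_zero_of_isUnit (isUnit_algebraMap_of_mem_nonZeroDivisors d.2)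
  have ha : v.1 (algebraMap R Q a) ≠ 0 := by
    rw [← hspec, map_mul]
    exact mul_ne_zero hq hd
  obtain ⟨m, b, hmb, hb⟩ := v.exists_eq_pow_mul_of_center_eq_span ht
    (s := algebraMap R (integralClosure R Q) d) hd
  obtain ⟨l, c, hlc, hc⟩ := v.exists_eq_pow_mul_of_center_eq_span ht
    (s := algebraMap R (integralClosure R Q) a) ha
  replace hmb : algebraMap R Q d = t ^ m * b := congrArg Subtype.val hmb
  replace hlc : algebraMap R Q a = t ^ l * c := congrArg Subtype.val hlc
  exact ⟨m, l, c, b, hc, hb, by rw [← hmb, hspec, hlc]⟩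

-- All nonzero values are powers of `v t`, so normalization leaves only one choice.
omit [IsLocalRing R] [IsNoetherianRing R] [Ring.KrullDimLE 1 R] in
theorem DiscreteValuationOver.map_generator (v : DiscreteValuationOver R Q)
    {t : integralClosure R Q} (ht : v.center = Ideal.span {t}) (ht' : (t : Q) ∈ Q⁰) :
    v.1 t = WithZero.exp (-1) := by
  have htc : v.1 t < 1 := v.mem_center.1 (ht ▸ Ideal.mem_span_singleton_self t)
  obtain ⟨q, hq⟩ := v.2.1 (WithZero.exp (-1))
  obtain ⟨m, l, a, b, ha, hb, h⟩ := v.exists_mul_pow_mul_eq ht (q := q) (by simp [hq])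
  replace h := congrArg v.1 h
  simp only [map_mul, map_pow, ha, hb, hq, mul_one] at h
  have ht0 : v.1 t ≠ 0 :=
    v.map_ne_zero_of_isUnit (isUnit_of_mem_nonZeroDivisors_of_isFractionRing R ht')
  have hlt : WithZero.log (v.1 t) < 0 := by rwa [WithZero.log_lt_iff_lt_exp ht0, WithZero.exp_zero]
  replace h := congrArg WithZero.log h
  rw [WithZero.log_mul (by simp) (pow_ne_zero _ ht0), WithZero.log_exp, WithZero.log_pow,
    WithZero.log_pow, nsmul_eq_mul, nsmul_eq_mul] at h
  have hdvd : WithZero.log (v.1 t) ∣ 1 := ⟨m - l, by linarith⟩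
  have hu := Int.isUnit_iff.1 (isUnit_of_dvd_one hdvd)
  have hlog : WithZero.log (v.1 t) = -1 := by lia
  rw [← hlog, WithZero.exp_log ht0]

omit [IsLocalRing R] [IsNoetherianRing R] [Ring.KrullDimLE 1 R] in
theorem DiscreteValuationOver.map_eq_of_center_eq {v w : DiscreteValuationOver R Q}
    (h : v.center = w.center) {t : integralClosure R Q} (ht : v.center = Ideal.span {t})
    (ht' : (t : Q) ∈ Q⁰) {q : Q} (hq : v.1 q ≠ 0) : w.1 q = v.1 q := by
  have hvt := v.map_generator ht ht'
  have hwt := w.map_generator (h ▸ ht) ht'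
  have hone : ∀ s : integralClosure R Q, v.1 s = 1 → w.1 s = 1 := by
    intro s hs
    refine le_antisymm (w.map_le_one_of_isIntegral s.2) (not_lt.1 fun hlt => ?_)
    rw [← w.mem_center, ← h, v.mem_center, hs] at hlt
    exact lt_irrefl _ hlt
  obtain ⟨m, l, a, b, ha, hb, he⟩ := v.exists_mul_pow_mul_eq ht hq
  have h1 := congrArg v.1 he
  have h2 := congrArg w.1 he
  simp only [map_mul, map_pow, ha, hb, hone a ha, hone b hb, hvt, hwt, mul_one] at h1 h2
  exact mul_right_cancel₀ (pow_ne_zero _ WithZero.exp_ne_zero) (h2.trans h1.symm)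

/-! ### Valuations when a power of `x` conducts the integral closure into `R` -/

section Conducted

variable {x : R} (hx : x ∈ maximalIdeal R) (hx0 : x ∈ R⁰)
  (hc : ∃ n, ∀ s : Q, IsIntegral R s → ∃ a, algebraMap R Q a = algebraMap R Q (x ^ n) * s)

include hx hx0 hc

theorem DiscreteValuationOver.center_injective :
    Function.Injective (DiscreteValuationOver.center (R := R) (Q := Q)) := by
  intro v w h
  obtain ⟨t, ht', ht⟩ :=
    exists_eq_span_singleton_of_isMaximal hx hx0 hc v.center v.center_isMaximal
  refine Subtype.ext (Valuation.ext fun q => ?_)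
  by_cases hq : v.1 q = 0
  -- `Q` need not be a field, so `v` may vanish on nonzero elements; exchanging `v` and `w` settles
  -- this case.
  · by_contra hne
    exact hne (map_eq_of_center_eq h.symm (h ▸ ht) ht' fun h0 => hne (hq.trans h0.symm))
  · exact (map_eq_of_center_eq h ht ht' hq).symm

theorem finite_discreteValuationOver : Finite (DiscreteValuationOver R Q) := by
  have hfin : Module.Finite R (integralClosure R Q) := Module.Finite.iff_fg.2
    (Submodule.fg_of_smul_mem_range (integralClosure R Q).toSubmodule
      (pow_mem hx0 hc.choose) hc.choose_spec)
  have hfinset := Algebra.QuasiFinite.finite_primesOver (S := integralClosure R Q) (maximalIdeal R)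
  have := hfinset.to_subtype
  refine Finite.of_injective
    (β := (maximalIdeal R).primesOver (integralClosure R Q)) (fun v => ⟨v.center, ?_, ⟨?_⟩⟩) ?_
  · infer_instance
  · have := v.center_isMaximal
    exact (eq_maximalIdeal (Ideal.isMaximal_comap_of_isIntegral_of_isMaximal v.center)).symm
  · intro v w h
    exact DiscreteValuationOver.center_injective hx hx0 hc (congrArg Subtype.val h)

/-- A generator of the center of `v` works: distinct valuations have distinct maximal centers, so it
lies in no other center. -/
theorem DiscreteValuationOver.exists_uniformizer (v : DiscreteValuationOver R Q) :
    ∃ t : integralClosure R Q, (t : Q) ∈ Q⁰ ∧ v.1 t = WithZero.exp (-1) ∧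
      ∀ w : DiscreteValuationOver R Q, w ≠ v → w.1 t = 1 := by
  obtain ⟨t, ht', ht⟩ :=
    exists_eq_span_singleton_of_isMaximal hx hx0 hc v.center v.center_isMaximal
  refine ⟨t, ht', v.map_generator ht ht', fun w hw => ?_⟩
  refine le_antisymm (w.map_le_one_of_isIntegral t.2) (not_lt.1 fun hlt => hw ?_)
  refine DiscreteValuationOver.center_injective hx hx0 hc
    (v.center_isMaximal.eq_of_le w.center_isMaximal.ne_top ?_).symm
  rw [ht, Ideal.span_singleton_le_iff_mem]
  exact hlt

/-- The conductor: `R` contains regular elements of all sufficiently large values. -/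
theorem exists_forall_exists_map_eq :
    ∃ c ∈ R⁰, ∀ δ : DiscreteValuationOver R Q → ℕ, ∃ a : R, algebraMap R Q a ∈ Q⁰ ∧
      ∀ v : DiscreteValuationOver R Q,
        v.1 (algebraMap R Q a) = v.1 (algebraMap R Q c) * WithZero.exp (-(δ v : ℤ)) := by
  classical
  have := finite_discreteValuationOver hx hx0 hc
  have := Fintype.ofFinite (DiscreteValuationOver R Q)
  choose t ht' ht hw using
    fun v : DiscreteValuationOver R Q => v.exists_uniformizer hx hx0 hc
  obtain ⟨n, hn⟩ := hc
  refine ⟨x ^ n, pow_mem hx0 n, fun δ => ?_⟩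
  -- A product of uniformizers is integral and has exactly the values `δ`; the factor `x ^ n` brings
  -- it into `R`.
  obtain ⟨a, ha⟩ := hn (∏ v, (t v : Q) ^ δ v)
    (IsIntegral.prod _ fun v _ => (t v).2.pow _)
  refine ⟨a, ?_, fun v => ?_⟩
  · rw [ha]
    exact mul_mem (isUnit_algebraMap_of_mem_nonZeroDivisors (pow_mem hx0 n)).mem_nonZeroDivisors
      (prod_mem fun v _ => pow_mem (ht' v) _)
  · rw [ha, map_mul, map_prod, Finset.prod_eq_single v]
    · have h1 := congrArg (· ^ δ v) (ht v)
      refine congrArg _ ((map_pow v.1 _ _).trans (h1.trans ?_))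
      simp [← WithZero.exp_nsmul]
    · intro w _ hwv
      rw [map_pow, hw w v hwv.symm, one_pow]
    · simp

/-- Write `q = a / b` with `a`, `b` integral and outside the center, and take the quotient of their
residues, lifted to `R`. -/
theorem DiscreteValuationOver.exists_map_sub_lt_one
    (hres : ∀ n : Ideal (integralClosure R Q), n.IsMaximal →
      Function.Surjective ((Ideal.Quotient.mk n).comp (algebraMap R (integralClosure R Q))))
    (v : DiscreteValuationOver R Q) {q : Q} (hq : v.1 q = 1) :
    ∃ u : R, v.1 (q - algebraMap R Q u) < 1 := by
  obtain ⟨t, ht', ht⟩ :=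
    exists_eq_span_singleton_of_isMaximal hx hx0 hc v.center v.center_isMaximal
  obtain ⟨m, l, a, b, ha, hb, he⟩ := v.exists_mul_pow_mul_eq ht (q := q) (by simp [hq])
  have hml : m = l := by
    have h1 := congrArg v.1 he
    simp only [map_mul, map_pow, ha, hb, hq, v.map_generator ht ht', mul_one, one_mul,
      ← WithZero.exp_nsmul, WithZero.exp_inj] at h1
    simpa using h1
  subst hml
  have hqb : q * b = a := by
    refine ((isUnit_of_mem_nonZeroDivisors_of_isFractionRing R ht').pow m).mul_left_cancel ?_
    rw [← he]
    ring
  have hred : ∀ s : integralClosure R Q, ∃ r : R, v.1 (s - algebraMap R Q r) < 1 := by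
    intro s
    obtain ⟨r, hr⟩ := hres v.center v.center_isMaximal (Ideal.Quotient.mk _ s)
    refine ⟨r, ?_⟩
    have := Ideal.Quotient.eq.1 hr.symm
    exact v.mem_center.1 this
  obtain ⟨r, hr⟩ := hred a
  obtain ⟨s, hs⟩ := hred b
  have hsu : IsUnit s := by
    by_contra hsu
    have h1 := v.1.map_add_lt hs (v.map_lt_one (x := s) hsu)
    rw [sub_add_cancel, hb] at h1
    exact lt_irrefl _ h1
  obtain ⟨s, rfl⟩ := hsu
  refine ⟨r * ↑s⁻¹, ?_⟩
  have h2 : v.1 ((q - algebraMap R Q (r * ↑s⁻¹)) * b) < 1 := by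
    have h3 : (q - algebraMap R Q (r * ↑s⁻¹)) * b = (a - algebraMap R Q r) -
        algebraMap R Q (r * ↑s⁻¹) * (b - algebraMap R Q s) := by
      have : algebraMap R Q (r * ↑s⁻¹) * algebraMap R Q s = algebraMap R Q r := by
        rw [← map_mul, Units.inv_mul_cancel_right]
      rw [sub_mul, hqb, mul_sub, this]
      ring
    rw [h3]
    refine v.1.map_sub_lt hr ?_
    rw [map_mul]
    exact (mul_le_of_le_one_left' (v.2.2 _)).trans_lt hs
  rwa [map_mul, hb, mul_one] at h2

end Conducted

end Valuations

/-! ### Conductors of subsets of `ℤ^ι` -/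

section Conductor

variable {ι : Type*} {E : Set (ι → ℤ)}

/-- The candidates are closed under infima, so one with minimal coordinate sum is least. -/
theorem exists_isLeast_conductor [Finite ι] (hinf : ∀ α ∈ E, ∀ β ∈ E, α ⊓ β ∈ E)
    (hne : ∃ γ : ι → ℤ, ∀ δ, γ ≤ δ → δ ∈ E) (hbdd : BddBelow E) :
    ∃ c, IsLeast {γ : ι → ℤ | γ ∈ E ∧ ∀ δ, γ ≤ δ → δ ∈ E} c := by
  have := Fintype.ofFinite ι
  obtain ⟨b, hb⟩ := hbdd
  set C := {γ : ι → ℤ | γ ∈ E ∧ ∀ δ, γ ≤ δ → δ ∈ E}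
  have hC : C.Nonempty := hne.imp fun γ h => ⟨h γ le_rfl, h⟩
  let μ : (ι → ℤ) → ℕ := fun γ => ∑ i, (γ i - b i).toNat
  obtain ⟨c, hc, hmin⟩ := WellFounded.has_min (InvImage.wf μ wellFounded_lt) C hC
  refine ⟨c, hc, fun γ hγ => ?_⟩
  have hcγ : c ⊓ γ ∈ C := by
    refine ⟨hinf _ hc.1 _ hγ.1, fun δ hδ => ?_⟩
    have := hinf _ (hc.2 (c ⊔ δ) le_sup_left) _ (hγ.2 (γ ⊔ δ) le_sup_left)
    rwa [← sup_inf_right, sup_eq_right.2 hδ] at this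
  by_contra hle
  obtain ⟨i, hi⟩ : ∃ i, γ i < c i := by
    simpa [Pi.le_def] using hle
  refine hmin _ hcγ (Finset.sum_lt_sum (fun j _ => ?_) ⟨i, Finset.mem_univ i, ?_⟩)
  · simp only [Pi.inf_apply]
    have := min_le_left (c j) (γ j)
    lia
  · have h1 : b i ≤ γ i := hb hγ.1 i
    simp only [Pi.inf_apply, min_eq_right hi.le]
    lia

/-- The coordinates other than `i` are raised one at a time; each step fixes the others and so
preserves the threshold `γ`. -/
theorem exists_mem_forall_le_of_raise [Finite ι] {γ : ι → ℤ}
    (hraise : ∀ β ∈ E, ∀ j, γ j ≤ β j → ∃ β' ∈ E, β j < β' j ∧ ∀ k, k ≠ j → β' k = β k)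
    {i : ι} {β : ι → ℤ} (hβ : β ∈ E) (hγ : ∀ j, j ≠ i → γ j ≤ β j) (δ : ι → ℤ) :
    ∃ β' ∈ E, β' i = β i ∧ ∀ j, j ≠ i → δ j ≤ β' j := by
  classical
  have := Fintype.ofFinite ι
  have hone : ∀ β ∈ E, ∀ j, γ j ≤ β j → ∀ n : ℕ,
      ∃ β' ∈ E, β j + n ≤ β' j ∧ ∀ k, k ≠ j → β' k = β k := by
    intro β hβ j hj n
    induction n with
    | zero => exact ⟨β, hβ, by simp, fun _ _ => rfl⟩
    | succ n ih =>
      obtain ⟨β', hβ', h1, h2⟩ := ih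
      obtain ⟨β'', hβ'', h3, h4⟩ := hraise β' hβ' j (by lia)
      exact ⟨β'', hβ'', by push_cast; lia, fun k hk => (h4 k hk).trans (h2 k hk)⟩
  suffices h : ∀ T : Finset ι, i ∉ T →
      ∃ β' ∈ E, β' i = β i ∧ (∀ j, j ≠ i → γ j ≤ β' j) ∧ ∀ j ∈ T, δ j ≤ β' j by
    obtain ⟨β', h1, h2, -, h3⟩ := h (Finset.univ.erase i) (Finset.notMem_erase _ _)
    exact ⟨β', h1, h2, fun j hj => h3 j (by simp [hj])⟩
  intro T
  induction T using Finset.induction_on with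
  | empty => exact fun _ => ⟨β, hβ, rfl, hγ, by simp⟩
  | insert a T ha ih =>
    intro hi
    rw [Finset.mem_insert, not_or] at hi
    obtain ⟨β', h1, h2, h3, h4⟩ := ih hi.2
    have hγa := h3 a (Ne.symm hi.1)
    obtain ⟨β'', h5, h6, h7⟩ := hone β' h1 a hγa (δ a - β' a).toNat
    refine ⟨β'', h5, (h7 i hi.1).trans h2, fun j hj => ?_, fun j hj => ?_⟩
    · by_cases hja : j = a
      · subst hja
        lia
      · exact (h7 j hja).symm ▸ h3 j hj
    · by_cases hja : j = a
      · subst hja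
        lia
      · exact (h7 j hja).symm ▸ h4 j (Finset.mem_of_mem_insert_of_ne hj hja)

theorem fiber_frobeniusVec_singleton [Finite ι] (hinf : ∀ α ∈ E, ∀ β ∈ E, α ⊓ β ∈ E)
    (hne : ∃ γ : ι → ℤ, ∀ δ, γ ≤ δ → δ ∈ E) (hbdd : BddBelow E)
    (hraise : ∀ γ : ι → ℤ, (∀ δ, γ ≤ δ → δ ∈ E) →
      ∀ β ∈ E, ∀ j, γ j ≤ β j → ∃ β' ∈ E, β j < β' j ∧ ∀ k, k ≠ j → β' k = β k) (i : ι) :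
    fiber E (frobeniusVec E) {i} = ∅ := by
  classical
  have hc : IsLeast {γ : ι → ℤ | γ ∈ E ∧ ∀ δ, γ ≤ δ → δ ∈ E} (conductorVec E) :=
    Classical.epsilon_spec (exists_isLeast_conductor hinf hne hbdd)
  set c := conductorVec E with hcdef
  have hf : ∀ j, frobeniusVec E j = c j - 1 := fun j => rfl
  refine Set.eq_empty_iff_forall_notMem.2 ?_
  rintro β ⟨hβ, h1, h2⟩
  have hβi : β i = c i - 1 := h1 i (Finset.mem_singleton_self i)
  have hβj : ∀ j, j ≠ i → c j ≤ β j := fun j hj => by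
    have := h2 j (by simpa using hj)
    rw [hf] at this
    lia
  -- If `δ i = c i - 1`, then `δ` is the infimum of `β` raised above `δ` off `i`, and `δ` with
  -- `i`-th coordinate increased to `c i`.
  have hmem : ∀ δ, Function.update c i (c i - 1) ≤ δ → δ ∈ E := by
    intro δ hδ
    have hδi : c i - 1 ≤ δ i := by simpa using hδ i
    have hδj : ∀ j, j ≠ i → c j ≤ δ j := fun j hj => by simpa [hj] using hδ j
    by_cases hi : c i ≤ δ i
    · refine hc.1.2 δ fun j => ?_
      by_cases hj : j = i
      · exact hj ▸ hi
      · exact hδj j hj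
    obtain ⟨β', h3, h4, h5⟩ :=
      exists_mem_forall_le_of_raise (hraise c hc.1.2) hβ hβj δ
    have h6 : Function.update δ i (c i) ∈ E := by
      refine hc.1.2 _ fun j => ?_
      by_cases hj : j = i
      · subst hj
        simp
      · simpa [hj] using hδj j hj
    have h7 : β' ⊓ Function.update δ i (c i) = δ := by
      funext j
      by_cases hj : j = i
      · subst hj
        simp only [Pi.inf_apply, Function.update_self]
        lia
      · simpa [hj] using h5 j hj
    exact h7 ▸ hinf _ h3 _ h6
  have := hc.2 (show Function.update c i (c i - 1) ∈ _ from ⟨hmem _ le_rfl, hmem⟩) i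
  simp at this

end Conductor

/-! ### Value sets of regular fractional ideals -/

section ValueSets

open IsLocalRing

variable {R : Type*} [CommRing R] {Q : Type*} [CommRing Q] [Algebra R Q] [IsFractionRing R Q]

theorem DiscreteValuationOver.map_eq_exp_neg_valueVec (v : DiscreteValuationOver R Q) {h : Q}
    (hh : h ∈ Q⁰) : v.1 h = WithZero.exp (-valueVec h v) := by
  rw [valueVec, neg_neg, WithZero.exp_log]
  exact v.map_ne_zero_of_isUnit (isUnit_of_mem_nonZeroDivisors_of_isFractionRing R hh)

omit [IsFractionRing R Q] in
theorem valueVec_eq_of_map_eq {v : DiscreteValuationOver R Q} {h : Q} {n : ℤ}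
    (hv : v.1 h = WithZero.exp (-n)) : valueVec h v = n := by
  rw [valueVec, hv, WithZero.log_exp, neg_neg]

theorem valueVec_mul {g h : Q} (hg : g ∈ Q⁰) (hh : h ∈ Q⁰) :
    valueVec (R := R) (g * h) = valueVec g + valueVec h := by
  funext v
  refine valueVec_eq_of_map_eq ?_
  rw [map_mul, v.map_eq_exp_neg_valueVec hg, v.map_eq_exp_neg_valueVec hh, ← WithZero.exp_add,
    Pi.add_apply, neg_add]

theorem valueSet_bddBelow {J : Submodule R Q} (hJ : IsFractional R⁰ J) : BddBelow (valueSet J) := by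
  obtain ⟨d, hd, hdJ⟩ := hJ
  have hdQ : algebraMap R Q d ∈ Q⁰ :=
    (isUnit_algebraMap_of_mem_nonZeroDivisors hd).mem_nonZeroDivisors
  refine ⟨-valueVec (algebraMap R Q d), ?_⟩
  rintro _ ⟨h, hh, hh0, rfl⟩ v
  obtain ⟨a, ha⟩ := hdJ h hh
  have h1 := v.2.2 a
  rw [ha, Algebra.smul_def, v.map_eq_exp_neg_valueVec (mul_mem hdQ hh0), ← WithZero.exp_zero,
    WithZero.exp_le_exp, valueVec_mul hdQ hh0, Pi.add_apply] at h1
  simp only [Pi.neg_apply]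
  lia

theorem fiber_valueSet_singleton_eq_empty {I J : Submodule R Q} {f α : DiscreteValuationOver R Q → ℤ}
    {i : DiscreteValuationOver R Q} (hf : fiber (valueSet J) f {i} = ∅)
    (hα : f - α ∈ valueSet (J / I)) : fiber (valueSet I) α {i} = ∅ := by
  refine Set.eq_empty_iff_forall_notMem.2 ?_
  rintro _ ⟨⟨h, hh, hh0, rfl⟩, h1, h2⟩
  obtain ⟨g, hg, hg0, hgα⟩ := hα
  refine Set.eq_empty_iff_forall_notMem.1 hf (valueVec (g * h))
    ⟨⟨g * h, Submodule.mem_div_iff_forall_mul_mem.1 hg h hh, mul_mem hg0 hh0, rfl⟩, ?_, ?_⟩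
  · intro j hj
    have := h1 j hj
    rw [valueVec_mul hg0 hh0, hgα, Pi.add_apply, Pi.sub_apply]
    lia
  · intro j hj
    have := h2 j hj
    rw [valueVec_mul hg0 hh0, hgα, Pi.add_apply, Pi.sub_apply]
    lia

theorem fiber_valueSet_div_singleton_eq_empty {I J : Submodule R Q}
    {f α : DiscreteValuationOver R Q → ℤ}
    {i : DiscreteValuationOver R Q} (hf : fiber (valueSet J) f {i} = ∅)
    (hα : α ∈ valueSet I) : fiber (valueSet (J / I)) (f - α) {i} = ∅ := by
  obtain ⟨h, hh, hh0, rfl⟩ := hα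
  -- The roles are exchanged through `h ∈ J : (J : I)`.
  refine fiber_valueSet_singleton_eq_empty hf ⟨h, ?_, hh0, (sub_sub_cancel _ _).symm⟩
  exact Submodule.mem_div_iff_forall_mul_mem.2 fun g hg =>
    mul_comm g h ▸ Submodule.mem_div_iff_forall_mul_mem.1 hg h hh

variable [IsLocalRing R] [IsNoetherianRing R] [Ring.KrullDimLE 1 R]

/-! ### Regular elements with prescribed values -/

section Regularize

variable {x : R} (hx : x ∈ maximalIdeal R) (hx0 : x ∈ R⁰)

include hx hx0

/-- Value sets see only regular elements, while sums may be zero divisors. Adding a multiple `x ^ n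
h` with `n ≥ 1` repairs this at an error smaller than `h`. -/
theorem exists_mem_nonZeroDivisors_map_sub_lt {J : Submodule R Q} {h y : Q} (hh : h ∈ J)
    (hh0 : h ∈ Q⁰) (hy : y ∈ J) :
    ∃ z ∈ J, z ∈ Q⁰ ∧ ∀ v : DiscreteValuationOver R Q, v.1 (z - y) < v.1 h := by
  obtain ⟨n, hn, hreg⟩ := exists_ge_add_pow_mul_mem_nonZeroDivisors hx hx0 hh0 y 1
  refine ⟨_, J.add_mem hy ?_, hreg, fun v => ?_⟩
  · rw [← Algebra.smul_def]
    exact J.smul_mem _ hh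
  · rw [add_sub_cancel_left, map_mul]
    refine mul_lt_of_lt_one_left (zero_lt_iff.2 ?_) (v.map_lt_one (Ideal.pow_mem_of_mem _ hx n hn))
    exact v.map_ne_zero_of_isUnit (isUnit_of_mem_nonZeroDivisors_of_isFractionRing R hh0)

variable (hres : ∀ (v : DiscreteValuationOver R Q) (q : Q), v.1 q = 1 →
  ∃ u : R, v.1 (q - algebraMap R Q u) < 1)

include hres

omit hx hx0 [IsLocalRing R] [IsNoetherianRing R] [Ring.KrullDimLE 1 R] in
theorem exists_map_sub_mul_lt (v : DiscreteValuationOver R Q) {g h : Q} (hg : g ∈ Q⁰)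
    (hgh : v.1 h = v.1 g) : ∃ u : R, v.1 (h - algebraMap R Q u * g) < v.1 g := by
  obtain ⟨g, rfl⟩ := isUnit_of_mem_nonZeroDivisors_of_isFractionRing R hg
  have hg0 : v.1 (g : Q) ≠ 0 := v.map_ne_zero_of_isUnit g.isUnit
  have h1 : v.1 (h * ↑g⁻¹) * v.1 (g : Q) = v.1 h := by rw [← map_mul, Units.inv_mul_cancel_right]
  obtain ⟨u, hu⟩ := hres v (h * ↑g⁻¹) (mul_right_cancel₀ hg0 (by rw [h1, hgh, one_mul]))
  refine ⟨u, ?_⟩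
  have h2 : h - algebraMap R Q u * g = (h * ↑g⁻¹ - algebraMap R Q u) * g := by
    rw [sub_mul, Units.inv_mul_cancel_right]
  rw [h2, map_mul]
  exact mul_lt_of_lt_one_left (zero_lt_iff.2 hg0) hu

/-- Choose `g ∈ J` with the value of `h` at `j` and larger values elsewhere; subtracting a suitable
`u g` cancels the leading term at `j` only. -/
theorem exists_mem_valueSet_raise {J : Submodule R Q} {γ : DiscreteValuationOver R Q → ℤ}
    (hγ : ∀ δ, γ ≤ δ → δ ∈ valueSet J) {β : DiscreteValuationOver R Q → ℤ} (hβ : β ∈ valueSet J)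
    {j : DiscreteValuationOver R Q} (hj : γ j ≤ β j) :
    ∃ β' ∈ valueSet J, β j < β' j ∧ ∀ k, k ≠ j → β' k = β k := by
  classical
  obtain ⟨h, hh, hh0, rfl⟩ := hβ
  obtain ⟨g, hg, hg0, hgv⟩ := hγ
    (fun k => if k = j then valueVec h j else max (valueVec h k + 1) (γ k)) (fun k => by
      by_cases hk : k = j
      · subst hk
        simpa using hj
      · simp [hk])
  have hgj : valueVec g j = valueVec h j := by rw [hgv]; simp
  have hgk : ∀ k, k ≠ j → valueVec h k < valueVec g k := by
    intro k hk
    rw [hgv]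
    simp only [hk, if_false]
    exact Int.lt_of_add_one_le (le_max_left _ _)
  obtain ⟨u, hu⟩ := exists_map_sub_mul_lt hres j hg0 (h := h)
    (by rw [j.map_eq_exp_neg_valueVec hg0, j.map_eq_exp_neg_valueVec hh0, hgj])
  obtain ⟨z, hz, hz0, hzv⟩ := exists_mem_nonZeroDivisors_map_sub_lt hx hx0 hh hh0
    (y := h - algebraMap R Q u * g)
    (J.sub_mem hh (by rw [← Algebra.smul_def]; exact J.smul_mem _ hg))
  refine ⟨_, ⟨z, hz, hz0, rfl⟩, ?_, fun k hk => ?_⟩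
  · have h1 : j.1 z < j.1 h := by
      have hgh : j.1 g = j.1 h := by
        rw [j.map_eq_exp_neg_valueVec hg0, j.map_eq_exp_neg_valueVec hh0, hgj]
      have := j.1.map_add_lt (hzv j) (hu.trans_eq hgh)
      rwa [sub_add_cancel] at this
    rw [j.map_eq_exp_neg_valueVec hz0, j.map_eq_exp_neg_valueVec hh0, WithZero.exp_lt_exp] at h1
    lia
  · refine valueVec_eq_of_map_eq ?_
    rw [← k.map_eq_exp_neg_valueVec hh0]
    refine k.1.map_eq_of_sub_lt ?_
    have h1 : z - h = (z - (h - algebraMap R Q u * g)) - algebraMap R Q u * g := by ring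
    rw [h1]
    refine k.1.map_sub_lt (hzv k) ?_
    rw [map_mul]
    refine (mul_le_of_le_one_left' (k.2.2 u)).trans_lt ?_
    rw [k.map_eq_exp_neg_valueVec hg0, k.map_eq_exp_neg_valueVec hh0, WithZero.exp_lt_exp]
    have := hgk k hk
    lia

/-- A combination `h + c g`, or `g` itself, has the minimal value at every `v` unless `c` hits a
forbidden residue there. -/
theorem inf_mem_valueSet [Finite (DiscreteValuationOver R Q)]
    (hcard : ENat.card (DiscreteValuationOver R Q) ≤ ENat.card (ResidueField R))
    {J : Submodule R Q} {α β : DiscreteValuationOver R Q → ℤ}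
    (hα : α ∈ valueSet J) (hβ : β ∈ valueSet J) : α ⊓ β ∈ valueSet J := by
  classical
  obtain ⟨h, hh, hh0, rfl⟩ := hα
  obtain ⟨g, hg, hg0, rfl⟩ := hβ
  suffices hy : ∃ y ∈ J, ∀ v : DiscreteValuationOver R Q, v.1 y = max (v.1 h) (v.1 g) by
    obtain ⟨y, hy, hyv⟩ := hy
    obtain ⟨z, hz, hz0, hzv⟩ := exists_mem_nonZeroDivisors_map_sub_lt hx hx0 hh hh0 hy
    refine ⟨z, hz, hz0, funext fun v => valueVec_eq_of_map_eq ?_⟩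
    have hzy : v.1 z = v.1 y :=
      v.1.map_eq_of_sub_lt ((hzv v).trans_le ((le_max_left _ _).trans_eq (hyv v).symm))
    rw [hzy, hyv, v.map_eq_exp_neg_valueVec hh0, v.map_eq_exp_neg_valueVec hg0, Pi.inf_apply]
    rcases le_total (valueVec h v) (valueVec g v) with h1 | h1
    · rw [inf_eq_left.2 h1, max_eq_left (WithZero.exp_le_exp.2 (neg_le_neg h1))]
    · rw [inf_eq_right.2 h1, max_eq_right (WithZero.exp_le_exp.2 (neg_le_neg h1))]
  have hu : ∀ v : DiscreteValuationOver R Q, ∃ u : R, v.1 h = v.1 g →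
      v.1 (h - algebraMap R Q u * g) < v.1 g := by
    intro v
    by_cases hv : v.1 h = v.1 g
    · exact (exists_map_sub_mul_lt hres v hg0 hv).imp fun _ h _ => h
    · exact ⟨0, fun h => absurd h hv⟩
  choose u hu using hu
  -- each valuation excludes one point of the projective line over the residue field
  let bad : DiscreteValuationOver R Q → Option (ResidueField R) := fun v =>
    if v.1 g < v.1 h then none else if v.1 h < v.1 g then some 0 else some (residue R (-u v))
  -- There are `r ≤ #k` forbidden points, but the projective line has `#k + 1`; for infinite `k`,
  -- finiteness of `r` suffices.
  have hbad : ¬ Function.Surjective bad := by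
    intro hs
    have hfin : Finite (Option (ResidueField R)) := Finite.of_surjective _ hs
    have : Finite (ResidueField R) := Finite.of_injective _ (Option.some_injective _)
    have h1 := Nat.card_le_card_of_surjective _ hs
    rw [ENat.card_eq_coe_natCard, ENat.card_eq_coe_natCard, ENat.natCast_le_natCast] at hcard
    rw [Finite.card_option] at h1
    lia
  obtain ⟨p, hp⟩ := not_forall.1 hbad
  replace hp := not_exists.1 hp
  have hunit : ∀ (v : DiscreteValuationOver R Q) {a : R}, IsUnit a → v.1 (algebraMap R Q a) = 1 := by
    rintro v _ ⟨a, rfl⟩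
    refine le_antisymm (v.2.2 a) ?_
    have h1 : v.1 (algebraMap R Q a) * v.1 (algebraMap R Q ↑a⁻¹) = 1 := by
      rw [← map_mul, ← map_mul, Units.mul_inv, map_one, map_one]
    exact h1.ge.trans (mul_le_of_le_one_right' (v.2.2 _))
  cases p with
  | none =>
    refine ⟨g, hg, fun v => (max_eq_right (not_lt.1 fun hlt => hp v ?_)).symm⟩
    simp only [bad, if_pos hlt]
  | some c =>
    obtain ⟨c, rfl⟩ := residue_surjective c
    refine ⟨h + algebraMap R Q c * g,
      J.add_mem hh (by rw [← Algebra.smul_def]; exact J.smul_mem _ hg), fun v => ?_⟩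
    rcases lt_trichotomy (v.1 g) (v.1 h) with hlt | heq | hlt
    · rw [max_eq_left hlt.le]
      refine v.1.map_add_eq_of_lt_left ?_
      rw [map_mul]
      exact (mul_le_of_le_one_left' (v.2.2 c)).trans_lt hlt
    · rw [heq, max_self, ← heq]
      have hc : IsUnit (u v + c) := by
        by_contra hc
        refine hp v ?_
        simp only [bad, heq, lt_irrefl, if_false]
        rw [map_neg, Option.some_inj, neg_eq_iff_add_eq_zero, ← map_add, residue_eq_zero_iff]
        exact hc
      have h1 : h + algebraMap R Q c * g =
          (h - algebraMap R Q (u v) * g) + algebraMap R Q (u v + c) * g := by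
        rw [map_add]
        ring
      have h2 : v.1 (algebraMap R Q (u v + c) * g) = v.1 g := by
        rw [map_mul, hunit v hc, one_mul]
      rw [h1, v.1.map_add_eq_of_lt_right (h2.symm ▸ hu v heq.symm), h2]
    · rw [max_eq_right hlt.le]
      have hc : IsUnit c := by
        by_contra hc
        refine hp v ?_
        simp only [bad, if_neg hlt.not_gt, if_pos hlt]
        rw [Option.some_inj, eq_comm, residue_eq_zero_iff]
        exact hc
      have h2 : v.1 (algebraMap R Q c * g) = v.1 g := by rw [map_mul, hunit v hc, one_mul]
      rw [v.1.map_add_eq_of_lt_right (h2.symm ▸ hlt), h2]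

end Regularize

omit [IsLocalRing R] [IsNoetherianRing R] [Ring.KrullDimLE 1 R] in
theorem exists_forall_ge_mem_valueSet {J : Submodule R Q} (hJ : ∃ h ∈ J, h ∈ Q⁰)
    (hR : ∃ c ∈ R⁰, ∀ δ : DiscreteValuationOver R Q → ℕ, ∃ a : R, algebraMap R Q a ∈ Q⁰ ∧
      ∀ v : DiscreteValuationOver R Q,
        v.1 (algebraMap R Q a) = v.1 (algebraMap R Q c) * WithZero.exp (-(δ v : ℤ))) :
    ∃ γ : DiscreteValuationOver R Q → ℤ, ∀ δ, γ ≤ δ → δ ∈ valueSet J := by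
  obtain ⟨h, hh, hh0⟩ := hJ
  obtain ⟨c, hc, hR⟩ := hR
  have hcQ : algebraMap R Q c ∈ Q⁰ :=
    (isUnit_algebraMap_of_mem_nonZeroDivisors hc).mem_nonZeroDivisors
  refine ⟨valueVec (algebraMap R Q c) + valueVec h, fun δ hδ => ?_⟩
  obtain ⟨a, ha0, ha⟩ := hR fun v => (δ v - (valueVec (algebraMap R Q c) v + valueVec h v)).toNat
  refine ⟨algebraMap R Q a * h, by rw [← Algebra.smul_def]; exact J.smul_mem _ hh,
    mul_mem ha0 hh0, ?_⟩
  rw [valueVec_mul ha0 hh0]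
  funext v
  have h1 : valueVec (algebraMap R Q a) v = valueVec (algebraMap R Q c) v +
      (δ v - (valueVec (algebraMap R Q c) v + valueVec h v)).toNat := by
    refine valueVec_eq_of_map_eq ?_
    rw [ha, v.map_eq_exp_neg_valueVec hcQ, ← WithZero.exp_add, neg_add]
  have h2 : valueVec (algebraMap R Q c) v + valueVec h v ≤ δ v := hδ v
  rw [Pi.add_apply, h1]
  lia

end ValueSets

/-! ### Admissible rings -/

section Admissible

open IsLocalRing

variable {R : Type*} [CommRing R] [IsLocalRing R] {Q : Type*} [CommRing Q] [Algebra R Q]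

theorem IsAdmissibleRing.krullDimLE_one (hR : IsAdmissibleRing R Q) : Ring.KrullDimLE 1 R :=
  (Order.krullDimLE_iff _ _).2 hR.dim_eq_one.le

theorem IsAdmissibleRing.exists_mem_nonZeroDivisors (hR : IsAdmissibleRing R Q) :
    ∃ x ∈ maximalIdeal R, x ∈ R⁰ := by
  obtain ⟨rs, hrs, hreg, hlen⟩ := hR.cohenMacaulay
  rw [hR.dim_eq_one] at hlen
  have hlen' : rs.length = 1 := by exact_mod_cast hlen
  obtain ⟨x, rfl⟩ := List.length_eq_one_iff.1 hlen'
  refine ⟨x, hrs x (by simp), ?_⟩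
  have h := (RingTheory.Sequence.isWeaklyRegular_singleton_iff R x).1 hreg.toIsWeaklyRegular
  exact mem_nonZeroDivisors_iff_right.2 fun y hy =>
    h (by simpa [mul_comm] using hy)

variable [IsFractionRing R Q]

theorem IsAdmissibleRing.finite_discreteValuationOver (hR : IsAdmissibleRing R Q) :
    Finite (DiscreteValuationOver R Q) := by
  have := hR.noetherian
  have := hR.krullDimLE_one
  have := hR.analyticallyReduced
  obtain ⟨x, hx, hx0⟩ := hR.exists_mem_nonZeroDivisors
  exact _root_.finite_discreteValuationOver hx hx0 (exists_pow_mul_mem_range_of_isIntegral hx hx0)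

/-- No element of the value set shares exactly one component with the Frobenius vector and is
larger in all others. -/
theorem IsAdmissibleRing.fiber_frobeniusVec_singleton (hR : IsAdmissibleRing R Q)
    {J : Submodule R Q} (hJ : IsRegularFractionalIdeal J) (i : DiscreteValuationOver R Q) :
    fiber (valueSet J) (frobeniusVec (valueSet J)) {i} = ∅ := by
  have := hR.noetherian
  have := hR.krullDimLE_one
  have := hR.analyticallyReduced
  have := hR.finite_discreteValuationOver
  obtain ⟨x, hx, hx0⟩ := hR.exists_mem_nonZeroDivisors
  have hc := exists_pow_mul_mem_range_of_isIntegral (Q := Q) hx hx0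
  have hres := fun (v : DiscreteValuationOver R Q) (q : Q) =>
    v.exists_map_sub_lt_one hx hx0 hc hR.residuallyRational (q := q)
  exact _root_.fiber_frobeniusVec_singleton
    (fun α hα β hβ => inf_mem_valueSet hx hx0 hres hR.largeResidueField hα hβ)
    (exists_forall_ge_mem_valueSet hJ.2 (exists_forall_exists_map_eq hx hx0 hc))
    (valueSet_bddBelow hJ.1)
    (fun γ hγ β hβ j hj => exists_mem_valueSet_raise hx hx0 hres hγ hβ hj) i

end Admissible

/-! ### Bounds for the invariants `p` and `q` -/

section MaximalPoints

variable {ι : Type*} {E : Set (ι → ℤ)} {α : ι → ℤ}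

theorem pInv_le_card : pInv E α ≤ Nat.card ι :=
  csSup_le ⟨0, Nat.zero_le _, fun J hJ h => absurd h (by simpa using hJ.ne_empty)⟩ fun _ h => h.1

theorem one_le_pInv (hι : 1 ≤ Nat.card ι) (h : ∀ i, fiber E α {i} = ∅) : 1 ≤ pInv E α := by
  refine le_csSup ⟨Nat.card ι, fun _ h => h.1⟩ ⟨hι, fun J hJ hJ1 => ?_⟩
  obtain ⟨i, rfl⟩ := Finset.card_eq_one.1 (le_antisymm hJ1 hJ.card_pos)
  exact h i

theorem qInv_le_card (hι : 1 ≤ Nat.card ι) (hα : α ∈ E) : qInv E α ≤ Nat.card ι := by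
  -- Only the full index set has `r` elements, and `α` itself lies in its fiber.
  refine Nat.sInf_le ⟨hι, fun J _ hJ => ⟨α, hα, fun _ _ => rfl, fun i hi => absurd ?_ hi⟩⟩
  have : Finite ι := Nat.finite_of_card_ne_zero (by lia)
  have := Fintype.ofFinite ι
  rw [Nat.card_eq_fintype_card] at hJ
  rw [Finset.card_eq_iff_eq_univ J |>.1 (le_antisymm (Finset.card_le_univ J) hJ)]
  exact Finset.mem_univ i

end MaximalPoints

theorem theorem3p9 {R : Type*} [CommRing R] [IsLocalRing R]
    {Q : Type*} [CommRing Q] [Algebra R Q] [IsFractionRing R Q]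
    (hR : IsAdmissibleRing R Q)
    (I J : Submodule R Q)
    (hI : IsRegularFractionalIdeal I) (hJ : IsRegularFractionalIdeal J)
    (α : DiscreteValuationOver R Q → ℤ)
    (hα : α ∈ valueSet I)
    (hα' : frobeniusVec (valueSet J) - α ∈ valueSet (J / I)) :
    (IsMaximalPoint (valueSet I) α ↔
      IsMaximalPoint (valueSet (J / I)) (frobeniusVec (valueSet J) - α)) ∧
    ∀ p q : ℤ, IsMaximalOfType (valueSet I) α p q →
      IsMaximalOfType (valueSet (J / I)) (frobeniusVec (valueSet J) - α)
        (rhoInv J (J / I) (frobeniusVec (valueSet J) - α) + 1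
          - (qInv (valueSet (J / (J / I))) α : ℤ))
        (rhoInv J I α + 1 - p) := by
  have hf := hR.fiber_frobeniusVec_singleton hJ
  have h1 : ∀ i, fiber (valueSet I) α {i} = ∅ :=
    fun i => fiber_valueSet_singleton_eq_empty (hf i) hα'
  have h2 : ∀ i, fiber (valueSet (J / I)) (frobeniusVec (valueSet J) - α) {i} = ∅ :=
    fun i => fiber_valueSet_div_singleton_eq_empty (hf i) hα
  have hmax : IsMaximalPoint (valueSet (J / I)) (frobeniusVec (valueSet J) - α) :=
    ⟨hα', Set.iUnion_eq_empty.2 h2⟩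
  refine ⟨iff_of_true ⟨hα, Set.iUnion_eq_empty.2 h1⟩ hmax, ?_⟩
  rintro p q ⟨-, hp1, -, rfl, -⟩
  -- `p ≥ 1` ensures that there is at least one valuation.
  have hι := hp1.trans pInv_le_card
  refine ⟨hmax, one_le_pInv hι h2, qInv_le_card hι hα', ?_, ?_⟩
  · rw [rhoInv, sub_sub_cancel]
    ring
  · rw [rhoInv]
    ring
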